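/- Let $F$ be a non-Archimedean local field with residue field $k_F$ of characteristic $p$, and fix a uniformiser $\pi_F$ of $F$. Let $\mathrm{ord}$ denote the unique valuation on algebraic extensions of $F$ extending that of $F$ with $\mathrm{ord}(\pi_F)=1$ (and $\mathrm{ord}(0)=\infty$). Let $E/F$ be a finite tamely ramified extension with ramification index $e=e(E|F)$, maximal ideal $\mathfrak p_E$ of its ring of integers, residue field $k_E$, and normalised valuation $\nu_E:E^\times\to\mathbb Z$. Let $C_E\subset E^\times$ be the subgroup generated by the roots of unity of order prime to $p$ in $E$ and a uniformiser $\pi_E$ of $E$ such that $\pi_E^{e}z=\pi_F$ for some root of unity $z\in E$ of order prime to $p$ (such a $\pi_E$ exists, and $C_E$ does not depend on its choice). For $c\in E^\times$, the standard representative $sr(c)$ is the unique element of $C_E$ such that $c\in sr(c)(1+\mathfrak p_E)$. Let $\beta\in E$ be nonzero with $E=F[\beta]$, and put $-r=\mathrm{ord}(\beta)$. Then the following assertions are equivalent. (i) The element $\beta$ is minimal over $F$; that is, (with $E=F[\beta]$) $\gcd(\nu_E(\beta),e)=1$ and the class $\pi_F^{-\nu_E(\beta)}\beta^{e}+\mathfrak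 p_E$ generates the residue field $k_E$ over $k_F$. (ii) The standard representative of $\beta$ generates $E/F$; that is, $F[sr(\beta)]=E$. (iii) For all morphisms of $F$-algebras $\sigma\neq\sigma'$ from $E$ to an algebraic closure $\overline F$ of $F$, one has $\mathrm{ord}(\sigma(\beta)-\sigma'(\beta))=-r$. -/

import Mathlib

open ValuativeRel

namespace LocalFieldExt

noncomputable section

/-- The normalised valuation `ν_K : Kˣ → ℤ` of a non-Archimedean local field `K`, written on `K`:
uniformisers have value `1`. (At `0` it takes the junk value `0`.) -/
def nu (K : Type*) [Field K] [ValuativeRel K] [TopologicalSpace K] [IsNonarchimedeanLocalField K]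
    (x : K) : ℤ :=
  -WithZero.log (IsNonarchimedeanLocalField.valueGroupWithZeroIsoInt K (valuation K x))

/-- `x` is a uniformiser of the local field `K`. -/
def IsUniformiser (K : Type*) [Field K] [ValuativeRel K] [TopologicalSpace K]
    [IsNonarchimedeanLocalField K] (x : K) : Prop :=
  nu K x = 1

/-- The residue characteristic `p` of the local field `F`. -/
def residueChar (F : Type*) [Field F] [ValuativeRel F] : ℕ := ringChar 𝓀[F]

/-- The valuation `ord` on an algebraic extension `L` of `F`, the unique one that extends `ν_F`
(so that `ord ϖ = 1` for uniformisers `ϖ` of `F`), with `ord 0 = ⊤`. For `x ≠ 0` it is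
`ν_F (N_{F(x)/F} x) / [F(x) : F]`, and up to sign the norm is the constant coefficient of the
minimal polynomial of `x`. -/
def ord (F : Type*) [Field F] [ValuativeRel F] [TopologicalSpace F]
    [IsNonarchimedeanLocalField F] {L : Type*} [Field L] [Algebra F L] (x : L) : WithTop ℚ :=
  open Classical in
  if x = 0 then ⊤
  else (((nu F ((minpoly F x).coeff 0) : ℚ) / ((minpoly F x).natDegree : ℚ) : ℚ) : WithTop ℚ)

/-- An extension of valued fields, in the sense of `Valuation.HasExtension`; this makes `𝒪[E]` an
algebra over `𝒪[F]` and `𝓀[E]` an algebra over `𝓀[F]`. -/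
instance hasExtension (F E : Type*) [Field F] [Field E] [ValuativeRel F] [ValuativeRel E]
    [Algebra F E] [ValuativeExtension F E] : (valuation F).HasExtension (valuation E) where
  val_isEquiv_comap := by
    intro a b
    rw [Valuation.comap_apply, Valuation.comap_apply,
      ← Valuation.Compatible.vle_iff_le, ← Valuation.Compatible.vle_iff_le,
      ValuativeExtension.vle_iff_vle]

section Extension

variable (F : Type*) [Field F] [ValuativeRel F] [TopologicalSpace F] [IsNonarchimedeanLocalField F]
variable (E : Type*) [Field E] [ValuativeRel E] [TopologicalSpace E] [IsNonarchimedeanLocalField E]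
variable [Algebra F E] [ValuativeExtension F E]

/-- The ramification index `e(E | F)`. -/
def ramIdx : ℕ := Ideal.ramificationIdx 𝓂[E] 𝒪[F]

/-- `E / F` is tamely ramified: `e(E | F)` is prime to the residue characteristic and the residue
field extension is separable. -/
def IsTamelyRamified : Prop :=
  (ramIdx F E).Coprime (residueChar F) ∧ Algebra.IsSeparable 𝓀[F] 𝓀[E]

variable {E}

/-- `β` is minimal relatively to `E / F`, where `ϖ` is a uniformiser of `F`:
`F[β] = E`, `gcd (ν_E β, e) = 1`, and the class of `ϖ ^ (-ν_E β) * β ^ e` generates the residue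
field `k_E` over `k_F`. -/
def IsMinimal (ϖ : F) (β : E) : Prop :=
  Algebra.adjoin F {β} = ⊤ ∧
  Int.gcd (nu E β) (ramIdx F E) = 1 ∧
  ∃ y : 𝒪[E], (y : E) = algebraMap F E ϖ ^ (-nu E β) * β ^ ramIdx F E ∧
    Algebra.adjoin 𝓀[F] {IsLocalRing.residue 𝒪[E] y} = ⊤

/-- `z` is a root of unity of order prime to the residue characteristic. -/
def IsTameRootOfUnity (z : Eˣ) : Prop :=
  IsOfFinOrder z ∧ (orderOf z).Coprime (residueChar F)

/-- `π` is a uniformiser of `E` with `π ^ e * z = ϖ` for some root of unity `z` of order prime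
to the residue characteristic. -/
def IsAdaptedUniformiser (ϖ : F) (π : Eˣ) : Prop :=
  IsUniformiser E (π : E) ∧
    ∃ z : Eˣ, IsTameRootOfUnity F z ∧ (π : E) ^ ramIdx F E * (z : E) = algebraMap F E ϖ

variable (E) in
/-- The group `C_E`, generated by the roots of unity of order prime to the residue characteristic
and an adapted uniformiser. Two adapted uniformisers of a tamely ramified extension differ by such
a root of unity, so that generating with all of them yields the same group as with any single one,
and no choice is needed. -/
def standardGroup (ϖ : F) : Subgroup Eˣ :=
  Subgroup.closure ({z | IsTameRootOfUnity F z} ∪ {π | IsAdaptedUniformiser F ϖ π})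

/-- `s` is a standard representative of `c`: `s ∈ C_E` and `c = s * (1 + y)` with `y ∈ 𝓂[E]`. -/
def IsStandardRep (ϖ : F) (c : E) (s : Eˣ) : Prop :=
  s ∈ standardGroup F E ϖ ∧ ∃ y : 𝒪[E], y ∈ 𝓂[E] ∧ c = (s : E) * (1 + (y : E))

/-- The standard representative `sr c` of `c ≠ 0`: the element (unique if `E / F` is
tamely ramified) of `C_E` with `c ∈ sr c * (1 + 𝓂[E])`. -/
def sr (ϖ : F) (c : E) : Eˣ := Classical.epsilon (IsStandardRep F ϖ c)

end Extension

end

end LocalFieldExt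

/-!
Write `𝒪`, `𝔭` for rings of integers and their maximal ideals, `e` for the ramification index,
`ν` for `ν_E β`, and call a root of unity tame if its order is prime to the residue
characteristic. Let `s = sr β`, so that `β = s (1 + y)` with `y ∈ 𝔭_E`. Every element `s` of `C_E`
satisfies `s ^ e = ϖ ^ ν ζ` with a tame root of unity `ζ`
(`exists_pow_eq_of_mem_standardGroup`), and `ζ` has the residue of `ϖ ^ (-ν) β ^ e`. All three
conditions thus become conditions on `s`.

* Minimality implies that `s` generates `E`: if `gcd (ν, e) = 1` and the residue of `ζ` generates
  `k_E`, then `F[s]` contains a uniformiser of `E` and all residues, and an intermediate field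
  with these properties is `E` by Nakayama's lemma (`eq_top_of_uniformiser_of_residue`). Nakayama's
  lemma applies because `𝒪_E` is a finite `𝒪_F`-module (`finite_integer`).
* Conversely, with `d = gcd (ν, e)` and `g = e / d`, the element `ξ = s ^ g ϖ ^ (-ν / d)` is again a
  tame root of unity. The field `F[ξ]` is unramified over `F`: its nonzero elements are powers of
  `ϖ` times units of `𝒪_F[ξ]` (`exists_eq_zpow_mul_unit_of_mem_adjoin`). If `F[s] = E`, an
  element of `E` is a sum of terms `a_j s ^ j` with `j < g` and `a_j ∈ F[ξ]`, whose valuations are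
  distinct modulo `e`, so that one term dominates. Applied to a uniformiser this gives `d = 1`,
  hence `ξ = ζ`, and applied to units it gives that the residue of `ζ` generates `k_E`
  (`gcd_eq_one_of_adjoin_eq_top`).
* For embeddings `σ`, `σ'` of `E`, the quotient `u = σ s / σ' s` is a root of unity of order
  prime to the residue characteristic, so in the integral closure of `𝒪_F` either `u = 1` or
  `u - 1` is a unit. Since `σ y` and `σ' y` lie in the Jacobson radical of that ring,
  `σ β - σ' β = σ' s ((u - 1) + u σ y - σ' y)` has order `ord β` precisely when
  `σ s ≠ σ' s` (`ord_sub_eq_iff`). As `E / F` is separable, being generated by tame roots of unity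
  and an adapted uniformiser (`separable_of_isTamelyRamified`), all pairs `σ ≠ σ'` are
  separated by `s` if and only if `s` generates `E`.

The order is handled through two facts: it is multiplicative, being computed by norms, and
an integral element has order zero if and only if it is a unit of the integral closure.
-/

namespace LocalFieldExt

/-! ### The normalised valuation -/

section Valuation

variable {K : Type*} [Field K] [ValuativeRel K]

theorem mem_maximalIdeal_iff_valuation {x : 𝒪[K]} : x ∈ 𝓂[K] ↔ valuation K (x : K) < 1 := by
  rw [IsLocalRing.mem_maximalIdeal, mem_nonunits_iff,
    Valuation.Integers.isUnit_iff_valuation_eq_one (Valuation.integer.integers (valuation K))]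
  exact (show valuation K (x : K) ≤ 1 from x.2).lt_iff_ne.symm

theorem isUnit_iff_valuation {x : 𝒪[K]} : IsUnit x ↔ valuation K (x : K) = 1 :=
  Valuation.Integers.isUnit_iff_valuation_eq_one (Valuation.integer.integers (valuation K))

end Valuation

section Nu

variable {K : Type*} [Field K] [ValuativeRel K] [TopologicalSpace K] [IsNonarchimedeanLocalField K]

theorem valuation_le_iff_nu_le {x y : K} (hx : x ≠ 0) (hy : y ≠ 0) :
    valuation K x ≤ valuation K y ↔ nu K y ≤ nu K x := by
  have h (z : K) (hz : z ≠ 0) :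
      IsNonarchimedeanLocalField.valueGroupWithZeroIsoInt K (valuation K z) ≠ 0 := by simpa using hz
  rw [nu, nu, neg_le_neg_iff, WithZero.log_le_log (h x hx) (h y hy)]
  exact (OrderIsoClass.map_le_map_iff _).symm

theorem nu_mul {x y : K} (hx : x ≠ 0) (hy : y ≠ 0) : nu K (x * y) = nu K x + nu K y := by
  have h (z : K) (hz : z ≠ 0) :
      IsNonarchimedeanLocalField.valueGroupWithZeroIsoInt K (valuation K z) ≠ 0 := by simpa using hz
  rw [nu, nu, nu, map_mul, map_mul, WithZero.log_mul (h x hx) (h y hy)]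
  ring

@[simp]
theorem nu_one : nu K 1 = 0 := by simp [nu]

theorem nu_inv {x : K} : nu K x⁻¹ = -nu K x := by
  simp [nu, map_inv₀, WithZero.log_inv]

theorem nu_zpow {x : K} (n : ℤ) : nu K (x ^ n) = n * nu K x := by
  simp [nu, map_zpow₀, WithZero.log_zpow]

theorem nu_pow {x : K} (n : ℕ) : nu K (x ^ n) = n * nu K x := by
  simp [nu, WithZero.log_pow]

theorem mem_integer_iff_nu {x : K} (hx : x ≠ 0) : x ∈ 𝒪[K] ↔ 0 ≤ nu K x := by
  rw [← nu_one (K := K), ← valuation_le_iff_nu_le hx one_ne_zero, map_one]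
  rfl

theorem valuation_lt_one_iff_nu {x : K} (hx : x ≠ 0) : valuation K x < 1 ↔ 0 < nu K x := by
  rw [← not_le, ← not_le, not_iff_not, ← map_one (valuation K),
    valuation_le_iff_nu_le one_ne_zero hx, nu_one]

theorem valuation_eq_one_iff_nu {x : K} (hx : x ≠ 0) : valuation K x = 1 ↔ nu K x = 0 := by
  rw [le_antisymm_iff, ← map_one (valuation K), valuation_le_iff_nu_le one_ne_zero hx,
    valuation_le_iff_nu_le hx one_ne_zero, nu_one, le_antisymm_iff, and_comm]

theorem isUnit_iff_nu {x : 𝒪[K]} : IsUnit x ↔ (x : K) ≠ 0 ∧ nu K (x : K) = 0 := by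
  rw [isUnit_iff_valuation]
  constructor
  · intro h
    have hx : (x : K) ≠ 0 := by
      intro h0
      simp [h0] at h
    exact ⟨hx, (valuation_eq_one_iff_nu hx).1 h⟩
  · rintro ⟨hx, h⟩
    exact (valuation_eq_one_iff_nu hx).2 h

theorem exists_unit_of_nu_eq_zero {x : K} (hx : x ≠ 0) (h : nu K x = 0) :
    ∃ u : 𝒪[K], IsUnit u ∧ (u : K) = x :=
  ⟨⟨x, (mem_integer_iff_nu hx).2 h.ge⟩, isUnit_iff_nu.2 ⟨hx, h⟩, rfl⟩

variable (K) in
/-- A nonzero element of normalised valuation one; the condition `x ≠ 0` is recorded for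
convenience, as `nu K 0 = 0`. -/
theorem exists_isUniformiser : ∃ x : K, x ≠ 0 ∧ IsUniformiser K x := by
  obtain ⟨x, hx⟩ := valuation_surjective
    ((IsNonarchimedeanLocalField.valueGroupWithZeroIsoInt K).symm (WithZero.exp (-1)))
  have h1 : nu K x = 1 := by simp [nu, hx]
  refine ⟨x, ?_, h1⟩
  rintro rfl
  simp [nu] at h1

theorem IsUniformiser.ne_zero {x : K} (hx : IsUniformiser K x) : x ≠ 0 := by
  rintro rfl
  simp [IsUniformiser, nu] at hx

theorem IsUniformiser.mem_integer {x : K} (hx : IsUniformiser K x) : x ∈ 𝒪[K] :=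
  (mem_integer_iff_nu hx.ne_zero).2 (by rw [hx]; norm_num)

theorem IsUniformiser.maximalIdeal_eq {x : K} (hx : IsUniformiser K x) :
    𝓂[K] = Ideal.span {(⟨x, hx.mem_integer⟩ : 𝒪[K])} := by
  ext y
  rw [mem_maximalIdeal_iff_valuation, Ideal.mem_span_singleton]
  constructor
  · intro h
    by_cases hy : (y : K) = 0
    · rw [show y = 0 from Subtype.ext hy]
      exact dvd_zero _
    rw [valuation_lt_one_iff_nu hy] at h
    have hq : (y : K) * x⁻¹ ∈ 𝒪[K] := by
      rw [mem_integer_iff_nu (mul_ne_zero hy (inv_ne_zero hx.ne_zero)),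
        nu_mul hy (inv_ne_zero hx.ne_zero), nu_inv, hx]
      lia
    refine ⟨⟨_, hq⟩, Subtype.ext ?_⟩
    change (y : K) = x * (y * x⁻¹)
    field_simp [hx.ne_zero]
  · rintro ⟨z, rfl⟩
    have hx1 : valuation K x < 1 := (valuation_lt_one_iff_nu hx.ne_zero).2 (by rw [hx]; norm_num)
    change valuation K (x * z) < 1
    rw [map_mul]
    exact mul_lt_one_of_lt_of_le hx1 z.2

/-- A unit is a product of a power of a uniformiser and a unit of the ring of integers. -/
theorem exists_eq_zpow_mul_unit {π x : K} (hπ : IsUniformiser K π) (hx : x ≠ 0) :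
    ∃ u : 𝒪[K], IsUnit u ∧ x = π ^ nu K x * u := by
  have h0 : π ^ (-nu K x) ≠ 0 := zpow_ne_zero _ hπ.ne_zero
  obtain ⟨u, hu, hux⟩ := exists_unit_of_nu_eq_zero (mul_ne_zero h0 hx)
    (by rw [nu_mul h0 hx, nu_zpow, hπ]; ring)
  refine ⟨u, hu, ?_⟩
  rw [hux, ← mul_assoc, ← zpow_add₀ hπ.ne_zero]
  simp

theorem nu_one_add {y : 𝒪[K]} (hy : y ∈ 𝓂[K]) : (1 + (y : K)) ≠ 0 ∧ nu K (1 + (y : K)) = 0 := by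
  have : IsUnit (1 + y) := by
    by_contra h
    have h1 : (1 + y) ∈ 𝓂[K] := h
    have h2 : (1 : 𝒪[K]) ∈ 𝓂[K] := by simpa using Ideal.sub_mem _ h1 hy
    exact (Ideal.ne_top_iff_one _).1 (IsLocalRing.maximalIdeal.isMaximal _).ne_top h2
  exact isUnit_iff_nu.1 this

/-- Two units with the same residue differ by a factor in `1 + 𝓂[K]`. -/
theorem exists_eq_mul_one_add {u w : 𝒪[K]} (hw : IsUnit w)
    (h : IsLocalRing.residue 𝒪[K] u = IsLocalRing.residue 𝒪[K] w) :
    ∃ y ∈ 𝓂[K], u = w * (1 + y) := by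
  obtain ⟨w, rfl⟩ := hw
  refine ⟨↑w⁻¹ * (u - w), Ideal.mul_mem_left _ _ ?_, ?_⟩
  · rw [← IsLocalRing.residue_eq_zero_iff, map_sub, h, sub_self]
  · rw [mul_add, mul_one, Units.mul_inv_cancel_left]
    ring

/-- Ultrametric inequality in the form: a nonzero sum whose nonzero terms have pairwise distinct
valuations is its dominant term, up to a factor in `1 + 𝓂[K]`. -/
theorem exists_sum_eq_mul_one_add {ι : Type*} (t : Finset ι) (a : ι → K)
    (h0 : ∑ i ∈ t, a i ≠ 0)
    (h : ∀ i ∈ t, ∀ j ∈ t, a i ≠ 0 → a j ≠ 0 → nu K (a i) = nu K (a j) → i = j) :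
    ∃ i ∈ t, a i ≠ 0 ∧ ∃ y : 𝒪[K], y ∈ 𝓂[K] ∧ ∑ j ∈ t, a j = a i * (1 + (y : K)) := by
  classical
  have hne : (t.filter (a · ≠ 0)).Nonempty := by
    obtain ⟨i, hi, hi0⟩ := Finset.exists_ne_zero_of_sum_ne_zero h0
    exact ⟨i, by simp [hi, hi0]⟩
  obtain ⟨i, hi, hmin⟩ := Finset.exists_min_image _ (fun i => nu K (a i)) hne
  rw [Finset.mem_filter] at hi
  have hlt : valuation K (∑ j ∈ t.erase i, a j) < valuation K (a i) := by
    refine Valuation.map_sum_lt _ (by simpa using hi.2) fun j hj => ?_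
    rw [Finset.mem_erase] at hj
    by_cases hj0 : a j = 0
    · rw [hj0, map_zero, zero_lt_iff]
      simpa using hi.2
    · rw [← not_le, valuation_le_iff_nu_le hi.2 hj0, not_le]
      refine lt_of_le_of_ne (hmin j (by simp [hj.2, hj0])) fun he => hj.1 ?_
      exact (h i hi.1 j hj.2 hi.2 hj0 he).symm
  have hy : valuation K ((a i)⁻¹ * ∑ j ∈ t.erase i, a j) < 1 := by
    rw [map_mul, map_inv₀]
    exact (inv_mul_lt_one₀ (zero_le.trans_lt hlt)).2 hlt
  refine ⟨i, hi.1, hi.2, ⟨_, hy.le⟩, mem_maximalIdeal_iff_valuation.2 hy, ?_⟩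
  change _ = a i * (1 + (a i)⁻¹ * ∑ j ∈ t.erase i, a j)
  rw [mul_add, mul_one, mul_inv_cancel_left₀ hi.2, Finset.add_sum_erase t a hi.1]

end Nu

/-! ### Completeness and Hensel's lemma -/

section Hensel

variable (K : Type*) [Field K] [ValuativeRel K] [TopologicalSpace K] [IsNonarchimedeanLocalField K]

theorem isAdicComplete_integer : IsAdicComplete 𝓂[K] 𝒪[K] := by
  let := IsTopologicalAddGroup.rightUniformSpace K
  have := isUniformAddGroup_of_addCommGroup (G := K)
  infer_instance

theorem henselianLocalRing_integer : HenselianLocalRing 𝒪[K] where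
  is_henselian f hf a h0 h1 := by
    have := isAdicComplete_integer K
    exact HenselianRing.is_henselian (I := 𝓂[K]) f hf a h0 (h1.map _)

end Hensel

/-! ### The ramification index -/

section RamificationIndex

variable (F : Type*) [Field F] [ValuativeRel F] [TopologicalSpace F] [IsNonarchimedeanLocalField F]
variable (E : Type*) [Field E] [ValuativeRel E] [TopologicalSpace E] [IsNonarchimedeanLocalField E]
variable [Algebra F E] [ValuativeExtension F E]

/-- The length defining the ramification index is the exponent of `𝓂[F] 𝒪[E]` as a power
of `𝓂[E]`. -/
theorem map_maximalIdeal : 𝓂[F].map (algebraMap 𝒪[F] 𝒪[E]) = 𝓂[E] ^ ramIdx F E := by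
  have hF : 𝓂[F] ≠ ⊥ := IsDiscreteValuationRing.not_a_field _
  have hne : 𝓂[F].map (algebraMap 𝒪[F] 𝒪[E]) ≠ ⊥ := Ideal.map_ne_bot_of_ne_bot hF
  obtain ⟨π, hπ⟩ := IsDiscreteValuationRing.exists_irreducible 𝒪[E]
  obtain ⟨n, hn⟩ := IsDiscreteValuationRing.ideal_eq_span_pow_irreducible hne hπ
  rw [← Ideal.span_singleton_pow, ← hπ.maximalIdeal_eq] at hn
  have h1 : Ideal.ramificationIdx' 𝓂[F] 𝓂[E] = n := by
    refine Ideal.ramificationIdx'_spec hn.le fun hle => ?_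
    rw [hn] at hle
    have := (Ideal.pow_right_strictAnti 𝓂[E] (IsDiscreteValuationRing.not_a_field _)
      (IsLocalRing.maximalIdeal.isMaximal _).ne_top) (Nat.lt_succ_self n)
    exact absurd hle (not_le_of_gt this)
  rw [hn, ← h1, Ideal.ramificationIdx'_eq_ramificationIdx' 𝓂[F] 𝓂[E] hne]
  rfl

variable {E}

/-- The ramification index is the normalised valuation of a uniformiser of the base. -/
theorem nu_algebraMap_of_isUniformiser {ϖ : F} (hϖ : IsUniformiser F ϖ) :
    nu E (algebraMap F E ϖ) = ramIdx F E := by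
  obtain ⟨π, hπ0, hπ⟩ := exists_isUniformiser E
  have hmap := map_maximalIdeal F E
  rw [hϖ.maximalIdeal_eq, hπ.maximalIdeal_eq, Ideal.map_span, Set.image_singleton,
    Ideal.span_singleton_pow, Ideal.span_singleton_eq_span_singleton] at hmap
  obtain ⟨u, hu⟩ := hmap
  have hu' : algebraMap F E ϖ * (u : 𝒪[E]) = π ^ ramIdx F E := congrArg Subtype.val hu
  obtain ⟨hu0, hu1⟩ := isUnit_iff_nu.1 u.isUnit
  have := congrArg (nu E) hu'
  rwa [nu_mul (by simpa using hϖ.ne_zero) hu0, hu1, nu_pow, hπ, mul_one, add_zero] at this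

variable (E) in
theorem ramIdx_pos : 0 < ramIdx F E := by
  obtain ⟨ϖ, hϖ0, hϖ⟩ := exists_isUniformiser F
  have h1 : valuation F ϖ < 1 := (valuation_lt_one_iff_nu hϖ0).2 (by rw [hϖ]; norm_num)
  have h2 : valuation E (algebraMap F E ϖ) < 1 :=
    (Valuation.HasExtension.val_map_lt_one_iff (valuation F) (valuation E) ϖ).2 h1
  rw [valuation_lt_one_iff_nu (by simpa using hϖ0), nu_algebraMap_of_isUniformiser F hϖ] at h2
  exact_mod_cast h2

end RamificationIndex

/-! ### Finiteness of the ring of integers -/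

section Finiteness

theorem isPrecomplete_pi {R : Type*} [CommRing R] (I : Ideal R) [IsPrecomplete I R]
    (ι : Type*) [Fintype ι] : IsPrecomplete I (ι → R) := by
  classical
  rw [← AdicCompletion.of_surjective_iff]
  intro y
  choose x hx using fun i =>
    AdicCompletion.of_surjective I R (AdicCompletion.piEquivOfFintype I (fun _ : ι => R) y i)
  refine ⟨x, (AdicCompletion.piEquivOfFintype I (fun _ : ι => R)).injective (funext fun i => ?_)⟩
  rw [← hx i, AdicCompletion.piEquivOfFintype_apply]
  rfl

variable (F : Type*) [Field F] [ValuativeRel F] [TopologicalSpace F] [IsNonarchimedeanLocalField F]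
variable (E : Type*) [Field E] [ValuativeRel E] [TopologicalSpace E] [IsNonarchimedeanLocalField E]
variable [Algebra F E] [ValuativeExtension F E]

/-- The ring of integers of `E` is finite over that of `F`: representatives of its finite quotient
by `𝓂[F]` generate it, because `𝒪[F]` is complete. -/
theorem finite_integer : Module.Finite 𝒪[F] 𝒪[E] := by
  have := isAdicComplete_integer F
  let I : Ideal 𝒪[E] := 𝓂[F].map (algebraMap 𝒪[F] 𝒪[E])
  have hI : I = 𝓂[E] ^ ramIdx F E := map_maximalIdeal F E
  have : Finite (𝒪[E] ⧸ 𝓂[E]) := inferInstanceAs (Finite 𝓀[E])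
  have hfin : Finite (𝒪[E] ⧸ I) := by
    rw [hI]
    exact Ideal.finite_quotient_pow (IsNoetherian.noetherian _) _
  cases nonempty_fintype (𝒪[E] ⧸ I)
  have hItop : I ≠ ⊤ := by
    rw [hI]
    exact fun h => (IsLocalRing.maximalIdeal.isMaximal 𝒪[E]).ne_top
      (top_le_iff.1 (h.ge.trans (Ideal.pow_le_self (ramIdx_pos F E).ne')))
  have : IsHausdorff 𝓂[F] 𝒪[E] :=
    IsHausdorff.map_algebraMap_iff.1 (IsHausdorff.of_isDomain _ hItop)
  -- the map sends a family of coefficients, indexed by the residue classes modulo `I`, to the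
  -- combination of chosen representatives of these classes
  let x : 𝒪[E] ⧸ I → 𝒪[E] := Quotient.out
  let f : ((𝒪[E] ⧸ I) → 𝒪[F]) →ₗ[𝒪[F]] 𝒪[E] := Fintype.linearCombination 𝒪[F] x
  have : IsPrecomplete 𝓂[F] ((𝒪[E] ⧸ I) → 𝒪[F]) := isPrecomplete_pi _ _
  refine Module.Finite.of_surjective f (surjective_of_mkQ_comp_surjective (I := 𝓂[F]) ?_)
  classical
  intro y
  obtain ⟨b, rfl⟩ := Submodule.mkQ_surjective _ y
  refine ⟨Pi.single (Ideal.Quotient.mk I b) 1, ?_⟩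
  have h1 : f (Pi.single (Ideal.Quotient.mk I b) 1) = x (Ideal.Quotient.mk I b) := by
    simp [f, Fintype.linearCombination_apply_single]
  rw [LinearMap.comp_apply, h1, Submodule.mkQ_apply, Submodule.mkQ_apply, Submodule.Quotient.eq,
    Ideal.smul_top_eq_map]
  change x (Ideal.Quotient.mk I b) - b ∈ I
  rw [← Ideal.Quotient.eq]
  exact Quotient.out_eq _

end Finiteness

/-! ### Intermediate fields with full residue field and a common uniformiser -/

section Generation

variable {F : Type*} [Field F] [ValuativeRel F] [TopologicalSpace F] [IsNonarchimedeanLocalField F]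
variable {E : Type*} [Field E] [ValuativeRel E] [TopologicalSpace E] [IsNonarchimedeanLocalField E]
variable [Algebra F E] [ValuativeExtension F E]

/-- An intermediate field of `E / F` that contains a uniformiser of `E` and represents all residue
classes is `E`: its integers span `𝒪[E]` modulo `𝓂[E] ^ e = 𝓂[F] 𝒪[E]`, and Nakayama's lemma applies. -/
theorem eq_top_of_uniformiser_of_residue (K : IntermediateField F E) {t : E}
    (ht : IsUniformiser E t) (htK : t ∈ K)
    (hres : ∀ c : 𝓀[E], ∃ b : 𝒪[E], (b : E) ∈ K ∧ IsLocalRing.residue 𝒪[E] b = c) : K = ⊤ := by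
  let N : Submodule 𝒪[F] 𝒪[E] :=
    { carrier := {b | (b : E) ∈ K}
      add_mem' := fun ha hb => K.add_mem ha hb
      zero_mem' := K.zero_mem
      smul_mem' := fun a b hb => K.smul_mem (x := (a : F)) hb }
  let t' : 𝒪[E] := ⟨t, ht.mem_integer⟩
  -- `𝒪[E] = N + t 𝒪[E]` and `t ^ n N ⊆ N`, so `𝒪[E] = N + t ^ n 𝒪[E]` for all `n`
  have happrox (n : ℕ) (b : 𝒪[E]) : ∃ m ∈ N, ∃ c, b = m + t' ^ n * c := by
    induction n with
    | zero => exact ⟨0, N.zero_mem, b, by simp⟩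
    | succ n ih =>
      obtain ⟨m, hm, c, rfl⟩ := ih
      obtain ⟨m', hm', hc⟩ := hres (IsLocalRing.residue _ c)
      have : c - m' ∈ 𝓂[E] := by
        rw [← IsLocalRing.residue_eq_zero_iff, map_sub, hc, sub_self]
      rw [ht.maximalIdeal_eq, Ideal.mem_span_singleton] at this
      obtain ⟨d, hd⟩ := this
      refine ⟨m + t' ^ n * m', N.add_mem hm (K.mul_mem (pow_mem htK n) hm'), d, ?_⟩
      rw [eq_add_of_sub_eq hd]
      ring
  have := finite_integer F E
  have hle : (⊤ : Submodule 𝒪[F] 𝒪[E]) ≤ N := by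
    refine Submodule.le_of_le_smul_of_le_jacobson_bot (I := 𝓂[F]) Module.Finite.fg_top
      (IsLocalRing.maximalIdeal_le_jacobson _) fun b _ => ?_
    obtain ⟨m, hm, c, rfl⟩ := happrox (ramIdx F E) b
    refine Submodule.add_mem_sup hm ?_
    rw [Ideal.smul_top_eq_map, map_maximalIdeal, ht.maximalIdeal_eq, Ideal.span_singleton_pow]
    exact Ideal.mul_mem_right _ _ (Ideal.mem_span_singleton_self _)
  rw [eq_top_iff]
  intro x _
  rcases (valuation E).valuationSubring.mem_or_inv_mem x with h | h
  · exact hle (x := ⟨x, h⟩) trivial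
  · exact inv_inv x ▸ K.inv_mem (hle (x := ⟨x⁻¹, h⟩) trivial)

end Generation

/-! ### Roots of unity of order prime to the residue characteristic -/

section TameRoots

/-- An exponent prime to the residue characteristic is nonzero in the residue field. -/
theorem natCast_residue_ne_zero {F : Type*} [Field F] [ValuativeRel F] {m : ℕ}
    (hm : m.Coprime (residueChar F)) : (m : 𝓀[F]) ≠ 0 := by
  intro h
  have h1 : residueChar F ∣ m := (ringChar.spec _ _).1 h
  have h2 : residueChar F = 1 := by simpa using (Nat.Coprime.symm hm).eq_one_of_dvd h1
  exact CharP.ringChar_ne_one h2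

theorem isUnit_natCast_integer {F : Type*} [Field F] [ValuativeRel F] {m : ℕ}
    (hm : m.Coprime (residueChar F)) : IsUnit (m : 𝒪[F]) := by
  rw [← IsLocalRing.residue_ne_zero_iff_isUnit, map_natCast]
  exact natCast_residue_ne_zero hm

theorem natCast_ne_zero_of_coprime {F : Type*} [Field F] [ValuativeRel F] {m : ℕ}
    (hm : m.Coprime (residueChar F)) : (m : F) ≠ 0 := by
  intro h
  refine (isUnit_natCast_integer hm).ne_zero (Subtype.ext ?_)
  push_cast
  exact h

/-- `z` is a root of unity of order prime to the residue characteristic of `F`: the variant of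
`IsTameRootOfUnity` for elements of a monoid instead of units of a field, with some exponent prime
to the residue characteristic in place of the order. -/
def IsTameRoot (F : Type*) [Field F] [ValuativeRel F] {R : Type*} [Monoid R] (z : R) : Prop :=
  ∃ m : ℕ, m.Coprime (residueChar F) ∧ z ^ m = 1

theorem isTameRootOfUnity_iff {F : Type*} [Field F] [ValuativeRel F] {E : Type*} [Field E]
    {z : Eˣ} : IsTameRootOfUnity F z ↔ IsTameRoot F (z : E) := by
  constructor
  · rintro ⟨-, h⟩
    exact ⟨orderOf z, h, by rw [← Units.val_pow_eq_pow_val, pow_orderOf_eq_one, Units.val_one]⟩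
  · rintro ⟨m, hm, h⟩
    have h' : z ^ m = 1 := Units.ext (by simpa using h)
    have hm0 : m ≠ 0 := by
      rintro rfl
      simpa using natCast_residue_ne_zero hm
    exact ⟨isOfFinOrder_iff_pow_eq_one.2 ⟨m, Nat.pos_of_ne_zero hm0, h'⟩,
      hm.coprime_dvd_left (orderOf_dvd_of_pow_eq_one h')⟩

namespace IsTameRoot

variable {F : Type*} [Field F] [ValuativeRel F]

theorem one {R : Type*} [Monoid R] : IsTameRoot F (1 : R) :=
  ⟨1, Nat.coprime_one_left _, one_pow _⟩

theorem mul {R : Type*} [CommMonoid R] {z w : R} (hz : IsTameRoot F z) (hw : IsTameRoot F w) :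
    IsTameRoot F (z * w) := by
  obtain ⟨m, hm, hz⟩ := hz
  obtain ⟨n, hn, hw⟩ := hw
  exact ⟨m * n, hm.mul_left hn, by rw [mul_pow, pow_mul, hz, mul_comm m n, pow_mul, hw]; simp⟩

theorem pow {R : Type*} [Monoid R] {z : R} (hz : IsTameRoot F z) (n : ℕ) :
    IsTameRoot F (z ^ n) := by
  obtain ⟨m, hm, hz⟩ := hz
  exact ⟨m, hm, by rw [← pow_mul, mul_comm, pow_mul, hz, one_pow]⟩

theorem of_pow {R : Type*} [Monoid R] {z : R} {n : ℕ} (hn : n.Coprime (residueChar F))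
    (hz : IsTameRoot F (z ^ n)) : IsTameRoot F z := by
  obtain ⟨m, hm, hz⟩ := hz
  exact ⟨n * m, hn.mul_left hm, by rw [pow_mul, hz]⟩

theorem inv {E : Type*} [Field E] {z : E} (hz : IsTameRoot F z) : IsTameRoot F z⁻¹ := by
  obtain ⟨m, hm, hz⟩ := hz
  exact ⟨m, hm, by rw [inv_pow, hz, inv_one]⟩

theorem map {R S : Type*} [Monoid R] [Monoid S] {z : R} (hz : IsTameRoot F z) (f : R →* S) :
    IsTameRoot F (f z) := by
  obtain ⟨m, hm, hz⟩ := hz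
  exact ⟨m, hm, by rw [← map_pow, hz, map_one]⟩

theorem ne_zero {E : Type*} [Field E] {z : E} (hz : IsTameRoot F z) : z ≠ 0 := by
  rintro rfl
  obtain ⟨m, hm, hz⟩ := hz
  have hm0 : m ≠ 0 := by
    rintro rfl
    simpa using natCast_residue_ne_zero hm
  rw [zero_pow hm0] at hz
  exact zero_ne_one hz

theorem nu_eq_zero {E : Type*} [Field E] [ValuativeRel E] [TopologicalSpace E]
    [IsNonarchimedeanLocalField E] {z : E} (hz : IsTameRoot F z) : nu E z = 0 := by
  obtain ⟨m, hm, hz⟩ := hz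
  have h := congrArg (nu E) hz
  rw [nu_pow, nu_one] at h
  rcases mul_eq_zero.1 h with h | h
  · rw [Nat.cast_eq_zero] at h
    subst h
    exact absurd Nat.cast_zero (natCast_residue_ne_zero hm)
  · exact h

theorem isSeparable {E : Type*} [Field E] [Algebra F E] {z : E} (hz : IsTameRoot F z) :
    IsSeparable F z := by
  obtain ⟨m, hm, hz⟩ := hz
  refine Polynomial.Separable.of_dvd (Polynomial.separable_X_pow_sub_C (1 : F)
    (natCast_ne_zero_of_coprime hm) one_ne_zero) (minpoly.dvd _ _ ?_)
  simp [hz]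

end IsTameRoot

variable {F : Type*} [Field F] [ValuativeRel F]
variable {E : Type*} [Field E] [ValuativeRel E] [TopologicalSpace E] [IsNonarchimedeanLocalField E]
variable [Algebra F E] [ValuativeExtension F E]

/-- Hensel's lemma for `m`-th roots of units, with `m` prime to the residue characteristic. -/
theorem exists_pow_eq_of_residue {m : ℕ} (hm : m.Coprime (residueChar F)) {w a : 𝒪[E]}
    (ha : IsUnit a) (h : IsLocalRing.residue 𝒪[E] (a ^ m) = IsLocalRing.residue 𝒪[E] w) :
    ∃ b : 𝒪[E], b ^ m = w ∧ IsLocalRing.residue 𝒪[E] b = IsLocalRing.residue 𝒪[E] a := by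
  have := henselianLocalRing_integer E
  have hm0 : m ≠ 0 := by
    rintro rfl
    simpa using natCast_residue_ne_zero hm
  have hmu : IsUnit (m : 𝒪[E]) := by
    simpa using (isUnit_natCast_integer hm).map (algebraMap 𝒪[F] 𝒪[E])
  obtain ⟨b, hb, hba⟩ := HenselianLocalRing.is_henselian (Polynomial.X ^ m - Polynomial.C w)
    (Polynomial.monic_X_pow_sub_C w hm0) a
    (by rw [← IsLocalRing.residue_eq_zero_iff]; simpa [sub_eq_zero] using h)
    (by simpa [Polynomial.derivative_X_pow] using hmu.mul (ha.pow (m - 1)))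
  refine ⟨b, ?_, ?_⟩
  · simpa [sub_eq_zero] using hb
  · rwa [← sub_eq_zero, ← map_sub, IsLocalRing.residue_eq_zero_iff]

/-- Teichmüller representatives: the residue of a unit is a `(q - 1)`-th root of unity, where
`q = #k_E`, and lifts by Hensel's lemma. -/
theorem exists_isTameRoot_residue_eq (F : Type*) [Field F] [ValuativeRel F] [TopologicalSpace F]
    [IsNonarchimedeanLocalField F] [Algebra F E] [ValuativeExtension F E] {u : 𝒪[E]}
    (hu : IsUnit u) :
    ∃ ζ : 𝒪[E], IsTameRoot F ζ ∧ IsLocalRing.residue 𝒪[E] ζ = IsLocalRing.residue 𝒪[E] u := by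
  cases nonempty_fintype 𝓀[E]
  have hp : (residueChar F).Prime := CharP.prime_ringChar (R := 𝓀[F])
  have hcard : residueChar F ∣ Fintype.card 𝓀[E] := by
    rw [residueChar, Algebra.ringChar_eq 𝓀[F] 𝓀[E], ← ringChar.spec, Nat.cast_card_eq_zero]
  have hone : 0 < Fintype.card 𝓀[E] := Fintype.card_pos
  have hm : (Fintype.card 𝓀[E] - 1).Coprime (residueChar F) := by
    rw [Nat.coprime_comm, hp.coprime_iff_not_dvd]
    intro h
    have := (Nat.dvd_sub hcard h)
    rw [Nat.sub_sub_self hone] at this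
    exact hp.one_lt.ne' (Nat.dvd_one.1 this)
  obtain ⟨ζ, h1, h2⟩ := exists_pow_eq_of_residue (w := 1) hm hu (by
    rw [map_pow, map_one, FiniteField.pow_card_sub_one_eq_one]
    exact (IsLocalRing.residue_ne_zero_iff_isUnit u).2 hu)
  exact ⟨ζ, ⟨_, hm, h1⟩, h2⟩

end TameRoots

/-! ### The group of standard representatives -/

section StandardGroup

variable {F : Type*} [Field F] [ValuativeRel F] [TopologicalSpace F] [IsNonarchimedeanLocalField F]
variable {E : Type*} [Field E] [ValuativeRel E] [TopologicalSpace E] [IsNonarchimedeanLocalField E]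
variable [Algebra F E] [ValuativeExtension F E]

/-- Existence of an adapted uniformiser in a tamely ramified extension. For any uniformiser `π`
one has `ϖ = π ^ e ζ (1 + y)` with a tame root of unity `ζ`, and `1 + y = b ^ e` by Hensel's lemma
as `e` is prime to the residue characteristic; then `π b` is adapted. -/
theorem exists_isAdaptedUniformiser (htame : (ramIdx F E).Coprime (residueChar F)) {ϖ : F}
    (hϖ : IsUniformiser F ϖ) : ∃ π : Eˣ, IsAdaptedUniformiser F ϖ π := by
  obtain ⟨π, hπ0, hπ⟩ := exists_isUniformiser E
  obtain ⟨u, hu, hux⟩ := exists_eq_zpow_mul_unit hπ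
    (show algebraMap F E ϖ ≠ 0 by simpa using hϖ.ne_zero)
  rw [nu_algebraMap_of_isUniformiser F hϖ, zpow_natCast] at hux
  obtain ⟨ζ, hζ, hres⟩ := exists_isTameRoot_residue_eq F hu
  have hζu : IsUnit ζ := by
    rwa [← IsLocalRing.residue_ne_zero_iff_isUnit, hres, IsLocalRing.residue_ne_zero_iff_isUnit]
  obtain ⟨y, hy, huy⟩ := exists_eq_mul_one_add hζu hres.symm
  obtain ⟨b, hb, hb1⟩ := exists_pow_eq_of_residue (F := F) htame (w := 1 + y) isUnit_one (by
    rw [map_add, (IsLocalRing.residue_eq_zero_iff y).2 hy]; simp)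
  have hbu : IsUnit b := by
    rw [← IsLocalRing.residue_ne_zero_iff_isUnit, hb1]
    simp
  obtain ⟨hb0, hbnu⟩ := isUnit_iff_nu.1 hbu
  have hζ' : IsTameRoot F (ζ : E) := hζ.map (𝒪[E].subtype : 𝒪[E] →* E)
  refine ⟨Units.mk0 (π * b) (mul_ne_zero hπ0 hb0), ?_, Units.mk0 (ζ : E) hζ'.ne_zero,
    isTameRootOfUnity_iff.2 hζ', ?_⟩
  · change nu E (π * b) = 1
    rw [nu_mul hπ0 hb0, hbnu, hπ, add_zero]
  · have hu' : (u : E) = (b : E) ^ ramIdx F E * ζ := by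
      rw [huy, ← hb, mul_comm]
      rfl
    rw [hux, hu', Units.val_mk0, Units.val_mk0, mul_pow]
    ring

/-- A tamely ramified extension is separable, also in equal characteristic: its elements separable
over `F` form an intermediate field that contains the tame roots of unity and an adapted
uniformiser. -/
theorem separable_of_isTamelyRamified [FiniteDimensional F E]
    (htame : (ramIdx F E).Coprime (residueChar F)) : Algebra.IsSeparable F E := by
  obtain ⟨ϖ, hϖ0, hϖ⟩ := exists_isUniformiser F
  obtain ⟨π, hπ, z, hz, hπz⟩ := exists_isAdaptedUniformiser (E := E) htame hϖ
  rw [isTameRootOfUnity_iff] at hz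
  rw [← separableClosure.eq_top_iff]
  refine eq_top_of_uniformiser_of_residue _ hπ ?_ fun c => ?_
  · rw [mem_separableClosure_iff]
    obtain ⟨m, hm, hzm⟩ := hz
    refine Polynomial.Separable.of_dvd (Polynomial.separable_X_pow_sub_C (ϖ ^ m)
      (natCast_ne_zero_of_coprime (htame.mul_left hm)) (pow_ne_zero m hϖ0))
      (minpoly.dvd _ _ ?_)
    have : (π : E) ^ (ramIdx F E * m) = algebraMap F E ϖ ^ m := by
      rw [← hπz, mul_pow, hzm, mul_one, pow_mul]
    simp [this]
  · by_cases hc : c = 0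
    · exact ⟨0, zero_mem _, by simp [hc]⟩
    obtain ⟨u, rfl⟩ := IsLocalRing.residue_surjective c
    rw [← ne_eq, IsLocalRing.residue_ne_zero_iff_isUnit] at hc
    obtain ⟨ζ, hζ, hres⟩ := exists_isTameRoot_residue_eq F hc
    refine ⟨ζ, ?_, hres⟩
    rw [mem_separableClosure_iff]
    exact (hζ.map (𝒪[E].subtype : 𝒪[E] →* E)).isSeparable

/-- Every nonzero element is a power of an adapted uniformiser times a Teichmüller representative
up to a factor in `1 + 𝓂[E]`. -/
theorem exists_isStandardRep (htame : (ramIdx F E).Coprime (residueChar F)) {ϖ : F}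
    (hϖ : IsUniformiser F ϖ) {c : E} (hc : c ≠ 0) : ∃ s, IsStandardRep F ϖ c s := by
  obtain ⟨π, hπ⟩ := exists_isAdaptedUniformiser (E := E) htame hϖ
  obtain ⟨u, hu, hcu⟩ := exists_eq_zpow_mul_unit hπ.1 hc
  obtain ⟨ζ, hζ, hres⟩ := exists_isTameRoot_residue_eq F hu
  have hζu : IsUnit ζ := by
    rwa [← IsLocalRing.residue_ne_zero_iff_isUnit, hres, IsLocalRing.residue_ne_zero_iff_isUnit]
  obtain ⟨y, hy, huy⟩ := exists_eq_mul_one_add hζu hres.symm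
  have hζ' : IsTameRoot F (ζ : E) := hζ.map (𝒪[E].subtype : 𝒪[E] →* E)
  refine ⟨π ^ nu E c * Units.mk0 (ζ : E) hζ'.ne_zero, Subgroup.mul_mem (standardGroup F E ϖ)
    (Subgroup.zpow_mem (standardGroup F E ϖ) (Subgroup.subset_closure (Or.inr hπ)) _)
    (Subgroup.subset_closure (Or.inl (isTameRootOfUnity_iff.2 hζ'))), y, hy, ?_⟩
  have hu' : (u : E) = ζ * (1 + y) := congrArg Subtype.val huy
  conv_lhs => rw [hcu, hu']
  simp [mul_assoc]

/-- The `e`-th power of an element of `C_E` is, up to a tame root of unity, a power of `ϖ`. -/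
theorem exists_pow_eq_of_mem_standardGroup {ϖ : F} (hϖ : IsUniformiser F ϖ) {s : Eˣ}
    (hs : s ∈ standardGroup F E ϖ) :
    ∃ ζ : E, IsTameRoot F ζ ∧
      (s : E) ^ ramIdx F E = algebraMap F E ϖ ^ nu E (s : E) * ζ := by
  have hϖ' : algebraMap F E ϖ ≠ 0 := by simpa using hϖ.ne_zero
  induction hs using Subgroup.closure_induction with
  | mem x hx =>
    rcases hx with hx | ⟨hx, z, hz, hxz⟩
    · have hx : IsTameRoot F (x : E) := isTameRootOfUnity_iff.1 hx
      exact ⟨_, hx.pow (ramIdx F E), by rw [hx.nu_eq_zero]; simp⟩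
    · refine ⟨_, (isTameRootOfUnity_iff.1 hz).inv, ?_⟩
      rw [show nu E (x : E) = 1 from hx, zpow_one, ← hxz, mul_assoc,
        mul_inv_cancel₀ z.ne_zero, mul_one]
  | one => exact ⟨1, .one, by simp⟩
  | mul x y _ _ hx hy =>
    obtain ⟨ζ, hζ, hx⟩ := hx
    obtain ⟨ξ, hξ, hy⟩ := hy
    refine ⟨_, hζ.mul hξ, ?_⟩
    rw [Units.val_mul, mul_pow, hx, hy, nu_mul x.ne_zero y.ne_zero, zpow_add₀ hϖ']
    ring
  | inv x _ hx =>
    obtain ⟨ζ, hζ, hx⟩ := hx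
    refine ⟨_, hζ.inv, ?_⟩
    rw [Units.val_inv_eq_inv_val, inv_pow, hx, nu_inv, zpow_neg, mul_inv]

end StandardGroup

/-! ### Extensions generated by a tame root of unity -/

section Unramified

open Polynomial

variable {F : Type*} [Field F] [ValuativeRel F] [TopologicalSpace F] [IsNonarchimedeanLocalField F]
variable {E : Type*} [Field E] [ValuativeRel E] [TopologicalSpace E] [IsNonarchimedeanLocalField E]
variable [Algebra F E] [ValuativeExtension F E]

theorem residue_aeval (z : 𝒪[E]) (P : 𝒪[F][X]) :
    IsLocalRing.residue 𝒪[E] (aeval z P) =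
      aeval (IsLocalRing.residue 𝒪[E] z) (P.map (IsLocalRing.residue 𝒪[F])) :=
  map_aeval_eq_aeval_map (φ := IsLocalRing.residue 𝒪[F]) (ψ := IsLocalRing.residue 𝒪[E]) rfl P z

theorem coe_mem_adjoin {F E : Type*} [Field F] [Field E] [ValuativeRel F] [ValuativeRel E]
    [Algebra F E] [ValuativeExtension F E] {z b : 𝒪[E]} (hb : b ∈ Algebra.adjoin 𝒪[F] {z}) :
    (b : E) ∈ Algebra.adjoin F {(z : E)} := by
  induction hb using Algebra.adjoin_induction with
  | mem x hx =>
    rw [Set.mem_singleton_iff] at hx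
    exact hx ▸ Algebra.self_mem_adjoin_singleton _ _
  | algebraMap r => exact Subalgebra.algebraMap_mem _ (r : F)
  | add x y _ _ hx hy => exact add_mem hx hy
  | mul x y _ _ hx hy => exact mul_mem hx hy

theorem exists_mem_adjoin_residue_eq {z : 𝒪[E]} {c : 𝓀[E]}
    (hc : c ∈ Algebra.adjoin 𝓀[F] {IsLocalRing.residue 𝒪[E] z}) :
    ∃ b ∈ Algebra.adjoin 𝒪[F] {z}, IsLocalRing.residue 𝒪[E] b = c := by
  obtain ⟨P, rfl⟩ := Algebra.adjoin_mem_exists_aeval _ _ hc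
  obtain ⟨Q, rfl⟩ := Polynomial.map_surjective _ (IsLocalRing.residue_surjective (R := 𝒪[F])) P
  exact ⟨aeval z Q, aeval_mem_adjoin_singleton _ _, residue_aeval z Q⟩

theorem residue_mem_adjoin {z b : 𝒪[E]} (hb : b ∈ Algebra.adjoin 𝒪[F] {z}) :
    IsLocalRing.residue 𝒪[E] b ∈ Algebra.adjoin 𝓀[F] {IsLocalRing.residue 𝒪[E] z} := by
  obtain ⟨P, rfl⟩ := Algebra.adjoin_mem_exists_aeval _ _ hb
  rw [residue_aeval]
  exact aeval_mem_adjoin_singleton _ _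

/-- An element of `𝒪[F][z]` that is a unit of `𝒪[E]` is a unit of `𝒪[F][z]`, since `𝒪[E]` is
integral over `𝒪[F]`. -/
theorem exists_mul_eq_one_of_isUnit {z b : 𝒪[E]} (hb : b ∈ Algebra.adjoin 𝒪[F] {z})
    (hu : IsUnit b) : ∃ w ∈ Algebra.adjoin 𝒪[F] {z}, b * w = 1 := by
  have := finite_integer F E
  have : Algebra.IsIntegral (Algebra.adjoin 𝒪[F] {z}) 𝒪[E] := Algebra.IsIntegral.tower_top 𝒪[F]
  obtain ⟨w, hw⟩ := (isUnit_of_map_unit (algebraMap (Algebra.adjoin 𝒪[F] {z}) 𝒪[E]) ⟨b, hb⟩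
    hu).exists_right_inv
  exact ⟨w, w.2, congrArg Subtype.val hw⟩

theorem exists_eq_C_mul_of_map_residue_eq_zero {ϖ : F} (hϖ : IsUniformiser F ϖ) {P : 𝒪[F][X]}
    (hP : P.map (IsLocalRing.residue 𝒪[F]) = 0) : ∃ R, P = C ⟨ϖ, hϖ.mem_integer⟩ * R := by
  refine (C_dvd_iff_dvd_coeff _ _).2 fun i => ?_
  rw [← Ideal.mem_span_singleton, ← hϖ.maximalIdeal_eq, ← IsLocalRing.residue_eq_zero_iff,
    ← coeff_map, hP, coeff_zero]

/-- `𝒪[F][ζ]` is unramified over `𝒪[F]` for a tame root of unity `ζ`: its elements that are not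
units are divisible by `ϖ`. The minimal polynomial of the residue of `ζ` is a simple factor of
`X ^ m - 1`, so that any lift of the cofactor takes a unit value at `ζ`, and any lift of
the minimal polynomial a value divisible by `ϖ`. -/
theorem exists_eq_uniformiser_mul {ϖ : F} (hϖ : IsUniformiser F ϖ) {ζ : 𝒪[E]}
    (hζ : IsTameRoot F ζ) {b : 𝒪[E]} (hb : b ∈ Algebra.adjoin 𝒪[F] {ζ}) (hbm : b ∈ 𝓂[E]) :
    ∃ y ∈ Algebra.adjoin 𝒪[F] {ζ}, b = algebraMap 𝒪[F] 𝒪[E] ⟨ϖ, hϖ.mem_integer⟩ * y := by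
  obtain ⟨m, hm, hζm⟩ := hζ
  have hsurj := Polynomial.map_surjective _ (IsLocalRing.residue_surjective (R := 𝒪[F]))
  set ξ := IsLocalRing.residue 𝒪[E] ζ with hξ
  have hξm : ξ ^ m = 1 := by rw [hξ, ← map_pow, hζm, map_one]
  obtain ⟨g₂, hg₂⟩ : minpoly 𝓀[F] ξ ∣ X ^ m - 1 := minpoly.dvd _ _ (by simp [hξm])
  obtain ⟨G, hG⟩ := hsurj (minpoly 𝓀[F] ξ)
  obtain ⟨G₂, hG₂⟩ := hsurj g₂
  -- `X ^ m - 1` has no multiple root in the residue field, since `m` is nonzero there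
  have hg₂ξ : aeval ξ g₂ ≠ 0 := by
    intro h0
    have hd := congrArg (fun p => aeval ξ (derivative p)) hg₂
    simp only [derivative_mul, map_add, map_mul, h0, minpoly.aeval, mul_zero, zero_mul, add_zero,
      derivative_sub, derivative_X_pow, derivative_one, sub_zero, map_pow, aeval_X,
      map_natCast] at hd
    have hm0 : (m : 𝓀[E]) ≠ 0 := by
      simpa using (map_ne_zero (algebraMap 𝓀[F] 𝓀[E])).2 (natCast_residue_ne_zero hm)
    have hξ0 : ξ ≠ 0 := by
      rintro h
      have hm' : m ≠ 0 := by
        rintro rfl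
        exact hm0 Nat.cast_zero
      rw [h, zero_pow hm'] at hξm
      exact zero_ne_one hξm
    exact mul_ne_zero hm0 (pow_ne_zero _ hξ0) hd
  have hG₂u : IsUnit (aeval ζ G₂) := by
    rw [← IsLocalRing.residue_ne_zero_iff_isUnit, residue_aeval, hG₂]
    exact hg₂ξ
  obtain ⟨w, hw, hG₂w⟩ := exists_mul_eq_one_of_isUnit (aeval_mem_adjoin_singleton 𝒪[F] ζ) hG₂u
  obtain ⟨R, hR⟩ := exists_eq_C_mul_of_map_residue_eq_zero hϖ (P := X ^ m - 1 - G * G₂)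
    (by simp [hG, hG₂, hg₂])
  have hGζ : aeval ζ G = algebraMap 𝒪[F] 𝒪[E] ⟨ϖ, hϖ.mem_integer⟩ * -(aeval ζ R * w) := by
    have h := congrArg (aeval ζ) hR
    simp only [map_sub, map_pow, aeval_X, hζm, map_one, sub_self, map_mul, aeval_C] at h
    linear_combination (-w) * h - (aeval ζ G) * hG₂w
  obtain ⟨P, rfl⟩ := Algebra.adjoin_mem_exists_aeval _ _ hb
  obtain ⟨h, hh⟩ : minpoly 𝓀[F] ξ ∣ P.map (IsLocalRing.residue 𝒪[F]) := minpoly.dvd _ _ (by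
    rw [← residue_aeval, IsLocalRing.residue_eq_zero_iff]
    exact hbm)
  obtain ⟨H, hH⟩ := hsurj h
  obtain ⟨R', hR'⟩ := exists_eq_C_mul_of_map_residue_eq_zero hϖ (P := P - G * H)
    (by simp [hG, hH, hh])
  refine ⟨aeval ζ R' - aeval ζ R * w * aeval ζ H, sub_mem (aeval_mem_adjoin_singleton _ _)
    (mul_mem (mul_mem (aeval_mem_adjoin_singleton _ _) hw) (aeval_mem_adjoin_singleton _ _)), ?_⟩
  have h := congrArg (aeval ζ) hR'
  simp only [map_sub, map_mul, aeval_C] at h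
  linear_combination h + (aeval ζ H) * hGζ

/-- The integral form of `exists_eq_zpow_mul_unit_of_mem_adjoin`: factors `ϖ` are split off until a
unit remains, by induction on the valuation. -/
theorem exists_eq_pow_mul_unit_of_mem_adjoin {ϖ : F} (hϖ : IsUniformiser F ϖ) {ζ : 𝒪[E]}
    (hζ : IsTameRoot F ζ) {b : 𝒪[E]} (hb : b ∈ Algebra.adjoin 𝒪[F] {ζ}) (hb0 : (b : E) ≠ 0) :
    ∃ k : ℕ, ∃ y ∈ Algebra.adjoin 𝒪[F] {ζ}, IsUnit y ∧
      (b : E) = algebraMap F E ϖ ^ k * (y : E) := by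
  induction hn : (nu E (b : E)).toNat using Nat.strong_induction_on generalizing b with
  | _ n ih =>
    by_cases hu : IsUnit b
    · exact ⟨0, b, hb, hu, by simp⟩
    obtain ⟨y, hy, hby⟩ := exists_eq_uniformiser_mul hϖ hζ hb hu
    have hby' : (b : E) = algebraMap F E ϖ * y := congrArg Subtype.val hby
    have hy0 : (y : E) ≠ 0 := right_ne_zero_of_mul (hby' ▸ hb0)
    have hynn : 0 ≤ nu E (y : E) := (mem_integer_iff_nu hy0).1 y.2
    have hnu : nu E (b : E) = ramIdx F E + nu E (y : E) := by
      rw [hby', nu_mul (by simpa using hϖ.ne_zero) hy0, nu_algebraMap_of_isUniformiser F hϖ]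
    have he := ramIdx_pos F E
    obtain ⟨k, w, hw, hwu, hyw⟩ := ih _ (by lia) hy hy0 rfl
    exact ⟨k + 1, w, hw, hwu, by rw [hby', hyw, pow_succ]; ring⟩

/-- A nonzero element of the field generated by a tame root of unity `ζ` is a power of `ϖ` times
a unit of `𝒪[F][ζ]`. -/
theorem exists_eq_zpow_mul_unit_of_mem_adjoin {ϖ : F} (hϖ : IsUniformiser F ϖ) {ζ : 𝒪[E]}
    (hζ : IsTameRoot F ζ) {x : E} (hx : x ∈ Algebra.adjoin F {(ζ : E)}) (hx0 : x ≠ 0) :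
    ∃ k : ℤ, ∃ y ∈ Algebra.adjoin 𝒪[F] {ζ}, IsUnit y ∧
      x = algebraMap F E ϖ ^ k * (y : E) := by
  have hϖ0 : algebraMap F E ϖ ≠ 0 := by simpa using hϖ.ne_zero
  have hϖS (n : ℕ) : algebraMap 𝒪[F] 𝒪[E] ⟨ϖ, hϖ.mem_integer⟩ ^ n ∈ Algebra.adjoin 𝒪[F] {ζ} :=
    pow_mem (Subalgebra.algebraMap_mem _ _) n
  -- a power of `ϖ` clears denominators
  have hden : ∃ n : ℕ, ∃ b ∈ Algebra.adjoin 𝒪[F] {ζ}, algebraMap F E ϖ ^ n * x = (b : E) := by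
    clear hx0
    induction hx using Algebra.adjoin_induction with
    | mem x hx =>
      rw [Set.mem_singleton_iff] at hx
      exact ⟨0, ζ, Algebra.self_mem_adjoin_singleton _ _, by simp [hx]⟩
    | algebraMap r =>
      by_cases hr : r = 0
      · exact ⟨0, 0, zero_mem _, by simp [hr]⟩
      refine ⟨(nu F r).natAbs, algebraMap 𝒪[F] 𝒪[E] ⟨ϖ ^ (nu F r).natAbs * r, ?_⟩,
        Subalgebra.algebraMap_mem _ _, ?_⟩
      · rw [mem_integer_iff_nu (mul_ne_zero (pow_ne_zero _ hϖ.ne_zero) hr),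
          nu_mul (pow_ne_zero _ hϖ.ne_zero) hr, nu_pow, hϖ]
        lia
      · change _ = algebraMap F E (ϖ ^ (nu F r).natAbs * r)
        rw [map_mul, map_pow]
    | add x y _ _ hx hy =>
      obtain ⟨n, b, hb, hnb⟩ := hx
      obtain ⟨k, c, hc, hkc⟩ := hy
      refine ⟨n + k, _, add_mem (mul_mem (hϖS k) hb) (mul_mem (hϖS n) hc), ?_⟩
      change _ = algebraMap F E ϖ ^ k * b + algebraMap F E ϖ ^ n * c
      rw [← hnb, ← hkc]
      ring
    | mul x y _ _ hx hy =>
      obtain ⟨n, b, hb, hnb⟩ := hx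
      obtain ⟨k, c, hc, hkc⟩ := hy
      refine ⟨n + k, _, mul_mem hb hc, ?_⟩
      change _ = (b : E) * c
      rw [← hnb, ← hkc]
      ring
  obtain ⟨n, b, hb, hnb⟩ := hden
  have hb0 : (b : E) ≠ 0 := hnb ▸ mul_ne_zero (pow_ne_zero n hϖ0) hx0
  obtain ⟨k, y, hy, hyu, hby⟩ := exists_eq_pow_mul_unit_of_mem_adjoin hϖ hζ hb hb0
  refine ⟨(k : ℤ) - n, y, hy, hyu, ?_⟩
  rw [zpow_sub₀ hϖ0, zpow_natCast, zpow_natCast, div_mul_eq_mul_div, ← hby, ← hnb,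
    mul_div_cancel_left₀ _ (pow_ne_zero n hϖ0)]

end Unramified

/-! ### Minimal elements and standard representatives -/

section Minimality

open Polynomial

variable {F : Type*} [Field F] [ValuativeRel F] [TopologicalSpace F] [IsNonarchimedeanLocalField F]
variable {E : Type*} [Field E] [ValuativeRel E] [TopologicalSpace E] [IsNonarchimedeanLocalField E]
variable [Algebra F E] [ValuativeExtension F E]

/-- If `s ^ g` lies in a subalgebra `K`, then `F[s]` is contained in `∑ K s ^ j` over `j < g`. -/
theorem exists_eq_sum_range {F E : Type*} [Field F] [Field E] [Algebra F E] (K : Subalgebra F E)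
    {s : E} {g : ℕ} (hg : 0 < g) (hs : s ^ g ∈ K) {x : E} (hx : x ∈ Algebra.adjoin F {s}) :
    ∃ a : ℕ → E, (∀ j, a j ∈ K) ∧ x = ∑ j ∈ Finset.range g, a j * s ^ j := by
  obtain ⟨P, rfl⟩ := Algebra.adjoin_mem_exists_aeval _ _ hx
  clear hx
  induction P using Polynomial.induction_on' with
  | add p q hp hq =>
    obtain ⟨a, ha, hpa⟩ := hp
    obtain ⟨b, hb, hqb⟩ := hq
    exact ⟨a + b, fun j => add_mem (ha j) (hb j), by
      simp [hpa, hqb, add_mul, Finset.sum_add_distrib]⟩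
  | monomial n c =>
    refine ⟨Pi.single (n % g) (algebraMap F E c * (s ^ g) ^ (n / g)), fun j => ?_, ?_⟩
    · rcases eq_or_ne j (n % g) with rfl | h
      · simpa using mul_mem (K.algebraMap_mem c) (pow_mem hs (n / g))
      · simp [h]
    · rw [Finset.sum_eq_single (n % g) (fun j _ hj => by simp [hj])
        (fun h => absurd (Finset.mem_range.2 (Nat.mod_lt n hg)) h)]
      rw [Pi.single_eq_same, aeval_monomial, mul_assoc, ← pow_mul, ← pow_add,
        Nat.div_add_mod]

/-- If `gcd (ν_E s, e) = 1` and the residue of `s ^ e / ϖ ^ ν_E s` generates the residue field, then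
`s` generates `E`. -/
theorem adjoin_eq_top_of_gcd_eq_one [FiniteDimensional F E] {ϖ : F} (hϖ : IsUniformiser F ϖ) {s : E}
    {ζ : 𝒪[E]} (hs : s ≠ 0) (hsζ : s ^ ramIdx F E = algebraMap F E ϖ ^ nu E s * ζ)
    (hgcd : Int.gcd (nu E s) (ramIdx F E) = 1)
    (hres : Algebra.adjoin 𝓀[F] {IsLocalRing.residue 𝒪[E] ζ} = ⊤) :
    Algebra.adjoin F {s} = ⊤ := by
  have hϖ0 : algebraMap F E ϖ ≠ 0 := by simpa using hϖ.ne_zero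
  let K := IntermediateField.adjoin F {s}
  have hsK : s ∈ K := IntermediateField.mem_adjoin_simple_self F s
  have hϖK : algebraMap F E ϖ ∈ K := K.algebraMap_mem ϖ
  have hζK : (ζ : E) ∈ K := by
    have : (ζ : E) = (algebraMap F E ϖ ^ nu E s)⁻¹ * s ^ ramIdx F E := by
      rw [hsζ, inv_mul_cancel_left₀ (zpow_ne_zero _ hϖ0)]
    rw [this]
    exact mul_mem (inv_mem (zpow_mem hϖK _)) (pow_mem hsK _)
  have hle : Algebra.adjoin F {(ζ : E)} ≤ K.toSubalgebra :=
    Algebra.adjoin_le (by simpa using hζK)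
  have hbez := Int.gcd_eq_gcd_ab (nu E s) (ramIdx F E)
  rw [hgcd, Nat.cast_one] at hbez
  have htop : K = ⊤ := by
    -- a Bézout relation `a ν_E(s) + b e = 1` provides the uniformiser `s ^ a ϖ ^ b`
    refine eq_top_of_uniformiser_of_residue K
      (t := s ^ Int.gcdA (nu E s) (ramIdx F E) * algebraMap F E ϖ ^ Int.gcdB (nu E s) (ramIdx F E))
      ?_ (mul_mem (zpow_mem hsK _) (zpow_mem hϖK _)) fun c => ?_
    · rw [IsUniformiser, nu_mul (zpow_ne_zero _ hs) (zpow_ne_zero _ hϖ0), nu_zpow, nu_zpow,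
        nu_algebraMap_of_isUniformiser F hϖ, hbez]
      ring
    · obtain ⟨b, hb, hbc⟩ := exists_mem_adjoin_residue_eq (F := F) (z := ζ) (c := c)
        (hres ▸ Algebra.mem_top)
      exact ⟨b, hle (coe_mem_adjoin hb), hbc⟩
  rw [← IntermediateField.adjoin_simple_toSubalgebra_of_isAlgebraic
    (Algebra.IsAlgebraic.isAlgebraic s)]
  change K.toSubalgebra = ⊤
  rw [htop, IntermediateField.top_toSubalgebra]

/-- Let `d = gcd (ν_E s, e)`. The element `s ^ (e / d) / ϖ ^ (ν_E s / d)` is a tame root of unity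
`ξ`, so a nonzero element of `F[s]` is a sum of terms `a_j s ^ j` with `j < e / d` and
`a_j ∈ F[ξ]`. As `F[ξ]` is unramified, these have distinct valuations, and the sum
is, up to a factor in `1 + 𝓂[E]`, one of them. -/
theorem gcd_eq_one_of_adjoin_eq_top (htame : (ramIdx F E).Coprime (residueChar F)) {ϖ : F}
    (hϖ : IsUniformiser F ϖ) {s : E} {ζ : 𝒪[E]} (hs : s ≠ 0) (hζ : IsTameRoot F ζ)
    (hsζ : s ^ ramIdx F E = algebraMap F E ϖ ^ nu E s * ζ) (htop : Algebra.adjoin F {s} = ⊤) :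
    Int.gcd (nu E s) (ramIdx F E) = 1 ∧
      Algebra.adjoin 𝓀[F] {IsLocalRing.residue 𝒪[E] ζ} = ⊤ := by
  have hϖ0 : algebraMap F E ϖ ≠ 0 := by simpa using hϖ.ne_zero
  have he := ramIdx_pos F E
  set d := Int.gcd (nu E s) (ramIdx F E) with hd
  have hd0 : 0 < d := Int.gcd_pos_of_ne_zero_right _ (by exact_mod_cast he.ne')
  obtain ⟨g, hg⟩ : d ∣ ramIdx F E := by
    have := Int.gcd_dvd_right (nu E s) (ramIdx F E)
    exact_mod_cast this
  obtain ⟨μ, hμ⟩ : (d : ℤ) ∣ nu E s := Int.gcd_dvd_left ..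
  have hg0 : 0 < g := Nat.pos_of_ne_zero (by rintro rfl; simp at hg; lia)
  have hcop : IsCoprime μ (g : ℤ) := by
    have h := Int.gcd_eq_gcd_ab (nu E s) (ramIdx F E)
    rw [← hd] at h
    refine ⟨Int.gcdA (nu E s) (ramIdx F E), Int.gcdB (nu E s) (ramIdx F E), ?_⟩
    have hd' : (d : ℤ) ≠ 0 := by exact_mod_cast hd0.ne'
    refine mul_left_cancel₀ hd' ?_
    have hg' : (ramIdx F E : ℤ) = d * g := by exact_mod_cast hg
    generalize Int.gcdA (nu E s) (ramIdx F E) = A at h ⊢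
    generalize Int.gcdB (nu E s) (ramIdx F E) = B at h ⊢
    rw [hμ, hg'] at h
    linear_combination -h
  -- the tame root of unity `ξ`, first as an element of `E`
  have hξE : IsTameRoot F (s ^ g * (algebraMap F E ϖ ^ μ)⁻¹) := by
    refine IsTameRoot.of_pow (n := d) (htame.coprime_dvd_left ⟨g, hg⟩) ?_
    have : (s ^ g * (algebraMap F E ϖ ^ μ)⁻¹) ^ d = ζ := by
      rw [mul_pow, ← pow_mul, mul_comm g d, ← hg, hsζ, hμ, inv_pow, ← zpow_natCast (_ ^ μ),
        ← zpow_mul, mul_comm μ, mul_comm, inv_mul_cancel_left₀ (zpow_ne_zero _ hϖ0)]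
    rw [this]
    exact hζ.map (𝒪[E].subtype : 𝒪[E] →* E)
  obtain ⟨ξ, -, hξ⟩ := exists_unit_of_nu_eq_zero hξE.ne_zero hξE.nu_eq_zero
  have hξt : IsTameRoot F ξ := by
    rw [← hξ] at hξE
    obtain ⟨m, hm, h⟩ := hξE
    exact ⟨m, hm, Subtype.ext h⟩
  have hsg : s ^ g = algebraMap F E ϖ ^ μ * ξ := by
    rw [hξ, mul_comm, inv_mul_cancel_right₀ (zpow_ne_zero _ hϖ0)]
  have hsgK : s ^ g ∈ Algebra.adjoin F {(ξ : E)} := by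
    rw [hsg, ← map_zpow₀]
    exact mul_mem (Subalgebra.algebraMap_mem _ _) (Algebra.self_mem_adjoin_singleton _ _)
  -- the dominant term of a nonzero element
  have key (x : E) (hx : x ≠ 0) : ∃ j < g, ∃ k : ℤ, ∃ b ∈ Algebra.adjoin 𝒪[F] {ξ}, IsUnit b ∧
      ∃ y : 𝒪[E], y ∈ 𝓂[E] ∧ x = algebraMap F E ϖ ^ k * b * s ^ j * (1 + (y : E)) := by
    obtain ⟨a, haK, hxa⟩ := exists_eq_sum_range _ hg0 hsgK (x := x) (htop ▸ Algebra.mem_top)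
    have hnu (j : ℕ) (hj : a j * s ^ j ≠ 0) :
        ∃ k : ℤ, nu E (a j * s ^ j) = d * (g * k + j * μ) := by
      obtain ⟨k, b, hb, hbu, hab⟩ :=
        exists_eq_zpow_mul_unit_of_mem_adjoin hϖ hξt (haK j) (left_ne_zero_of_mul hj)
      obtain ⟨hb0, hb1⟩ := isUnit_iff_nu.1 hbu
      refine ⟨k, ?_⟩
      rw [hab, nu_mul (mul_ne_zero (zpow_ne_zero _ hϖ0) hb0) (pow_ne_zero _ hs),
        nu_mul (zpow_ne_zero _ hϖ0) hb0, hb1, nu_zpow, nu_pow,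
        nu_algebraMap_of_isUniformiser F hϖ, hμ, hg]
      push_cast
      ring
    have hx' := hx
    rw [hxa] at hx'
    obtain ⟨j, hj, hj0, y, hy, hsum⟩ := exists_sum_eq_mul_one_add _ _ hx' (by
      intro i hi j hj hi0 hj0 hij
      obtain ⟨k, hk⟩ := hnu i hi0
      obtain ⟨l, hl⟩ := hnu j hj0
      rw [hk, hl] at hij
      have hij' := mul_left_cancel₀ (by exact_mod_cast hd0.ne') hij
      have hdvd : (g : ℤ) ∣ μ * ((i : ℤ) - j) := ⟨l - k, by linear_combination hij'⟩
      have hdvd' := hcop.symm.dvd_of_dvd_mul_left hdvd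
      have h1 := Finset.mem_range.1 hi
      have h2 := Finset.mem_range.1 hj
      have h3 := Int.eq_zero_of_abs_lt_dvd hdvd' (by rw [abs_lt]; lia)
      lia)
    obtain ⟨k, b, hb, hbu, hab⟩ :=
      exists_eq_zpow_mul_unit_of_mem_adjoin hϖ hξt (haK j) (left_ne_zero_of_mul hj0)
    exact ⟨j, Finset.mem_range.1 hj, k, b, hb, hbu, y, hy, by rw [hxa, hsum, hab]⟩
  have hnu (j : ℕ) (k : ℤ) (b y : 𝒪[E]) (hb : IsUnit b) (hy : y ∈ 𝓂[E]) :
      nu E (algebraMap F E ϖ ^ k * b * s ^ j * (1 + (y : E))) = d * (g * k + j * μ) := by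
    obtain ⟨hb0, hb1⟩ := isUnit_iff_nu.1 hb
    obtain ⟨hy0, hy1⟩ := nu_one_add hy
    have h1 := mul_ne_zero (zpow_ne_zero k hϖ0) hb0
    rw [nu_mul (mul_ne_zero h1 (pow_ne_zero _ hs)) hy0, nu_mul h1 (pow_ne_zero _ hs),
      nu_mul (zpow_ne_zero _ hϖ0) hb0, hb1, hy1, nu_zpow, nu_pow,
      nu_algebraMap_of_isUniformiser F hϖ, hμ, hg]
    push_cast
    ring
  -- `d` divides every value of `ν_E`
  have hd1 : d = 1 := by
    obtain ⟨x, hx0, hx⟩ := exists_isUniformiser E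
    obtain ⟨j, -, k, b, -, hbu, y, hy, hxe⟩ := key x hx0
    have h := hnu j k b y hbu hy
    rw [← hxe, hx] at h
    have : (d : ℤ) ∣ 1 := ⟨_, h⟩
    exact Nat.dvd_one.1 (by exact_mod_cast this)
  refine ⟨hd1, ?_⟩
  have hξζ : ξ = ζ := by
    refine Subtype.ext ?_
    rw [hd1, one_mul] at hg
    rw [hd1, Nat.cast_one, one_mul] at hμ
    rw [hg, hμ, hsg] at hsζ
    exact mul_left_cancel₀ (zpow_ne_zero _ hϖ0) hsζ
  rw [← hξζ, eq_top_iff]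
  intro c _
  by_cases hc : c = 0
  · exact hc ▸ zero_mem _
  obtain ⟨u, rfl⟩ := IsLocalRing.residue_surjective c
  rw [← ne_eq, IsLocalRing.residue_ne_zero_iff_isUnit] at hc
  obtain ⟨hu0, hu1⟩ := isUnit_iff_nu.1 hc
  obtain ⟨j, hj, k, b, hb, hbu, y, hy, hxe⟩ := key u hu0
  have h := hnu j k b y hbu hy
  rw [← hxe, hu1, hd1, Nat.cast_one, one_mul] at h
  have hj0 : j = 0 := by
    have hdvd : (g : ℤ) ∣ μ * (j : ℤ) := ⟨-k, by linear_combination -h⟩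
    have hdvd' : g ∣ j := by exact_mod_cast hcop.symm.dvd_of_dvd_mul_left hdvd
    exact Nat.eq_zero_of_dvd_of_lt hdvd' hj
  have hk0 : k = 0 := by
    rw [hj0, Nat.cast_zero, zero_mul, add_zero, eq_comm, mul_eq_zero] at h
    exact h.resolve_left (by exact_mod_cast hg0.ne')
  have hub : u = b * (1 + y) := Subtype.ext (by rw [hxe, hj0, hk0]; simp)
  rw [hub, map_mul, map_add, (IsLocalRing.residue_eq_zero_iff y).2 hy, map_one, add_zero, mul_one]
  exact residue_mem_adjoin hb

/-- Since `β = s (1 + y)` with `y ∈ 𝓂[E]`, both `ν_E` and the residue class occurring in the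
definition of minimality can be computed from `s`. -/
theorem isMinimal_iff_adjoin_standardRep_eq_top [FiniteDimensional F E]
    (htame : (ramIdx F E).Coprime (residueChar F)) {ϖ : F} (hϖ : IsUniformiser F ϖ) {β : E}
    (hgen : Algebra.adjoin F {β} = ⊤) {s : Eˣ} (hs : IsStandardRep F ϖ β s) :
    IsMinimal F ϖ β ↔ Algebra.adjoin F {(s : E)} = ⊤ := by
  have hϖ0 : algebraMap F E ϖ ≠ 0 := by simpa using hϖ.ne_zero
  obtain ⟨hsC, y, hy, hβ⟩ := hs
  obtain ⟨hy0, hy1⟩ := nu_one_add hy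
  obtain ⟨ζ', hζ', hsζ⟩ := exists_pow_eq_of_mem_standardGroup hϖ hsC
  obtain ⟨ζ, -, rfl⟩ := exists_unit_of_nu_eq_zero hζ'.ne_zero hζ'.nu_eq_zero
  have hζ : IsTameRoot F ζ := by
    obtain ⟨m, hm, h⟩ := hζ'
    exact ⟨m, hm, Subtype.ext h⟩
  have hnu : nu E β = nu E (s : E) := by rw [hβ, nu_mul s.ne_zero hy0, hy1, add_zero]
  have hz : ((ζ * (1 + y) ^ ramIdx F E : 𝒪[E]) : E) =
      algebraMap F E ϖ ^ (-nu E β) * β ^ ramIdx F E := by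
    conv_rhs => rw [hnu, hβ, mul_pow, hsζ, zpow_neg, ← mul_assoc,
      inv_mul_cancel_left₀ (zpow_ne_zero _ hϖ0)]
    rfl
  have hres : IsLocalRing.residue 𝒪[E] (ζ * (1 + y) ^ ramIdx F E) =
      IsLocalRing.residue 𝒪[E] ζ := by
    rw [map_mul, map_pow, map_add, (IsLocalRing.residue_eq_zero_iff y).2 hy]
    simp
  constructor
  · rintro ⟨-, hgcd, z, hz', hzres⟩
    obtain rfl : z = ζ * (1 + y) ^ ramIdx F E := Subtype.ext (hz'.trans hz.symm)
    exact adjoin_eq_top_of_gcd_eq_one hϖ s.ne_zero hsζ (hnu ▸ hgcd) (hres ▸ hzres)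
  · intro htop
    obtain ⟨h1, h2⟩ := gcd_eq_one_of_adjoin_eq_top htame hϖ s.ne_zero hζ hsζ htop
    exact ⟨hgen, hnu ▸ h1, _, hz, hres ▸ h2⟩

end Minimality

/-! ### Multiplicativity of the order -/

section Order

variable {F : Type*} [Field F] [ValuativeRel F] [TopologicalSpace F] [IsNonarchimedeanLocalField F]
variable {L : Type*} [Field L] [Algebra F L]

theorem coeff_zero_minpoly_ne_zero {F L : Type*} [Field F] [Field L] [Algebra F L]
    [Algebra.IsAlgebraic F L] {x : L} (hx : x ≠ 0) :
    (minpoly F x).coeff 0 ≠ 0 :=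
  minpoly.coeff_zero_ne_zero (Algebra.IsIntegral.isIntegral x) hx

theorem nu_neg_one_pow (n : ℕ) : nu F ((-1) ^ n) = 0 := by
  rcases neg_one_pow_eq_or F n with h | h
  · rw [h, nu_one]
  · have h2 : 2 * nu F (-1) = 0 := by
      rw [← Nat.cast_ofNat, ← nu_pow]
      simp
    rw [h]
    lia

/-- `ord` can be computed from the norm of any finite extension containing the element. -/
theorem ord_eq_norm [FiniteDimensional F L] {x : L} (hx : x ≠ 0) :
    ord F x = ((nu F (Algebra.norm F x) / Module.finrank F L : ℚ) : WithTop ℚ) := by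
  have hint : IsIntegral F x := Algebra.IsIntegral.isIntegral x
  have hnorm : Algebra.norm F x = ((-1) ^ (minpoly F x).natDegree * (minpoly F x).coeff 0) ^
      Module.finrank (IntermediateField.adjoin F {x}) L := by
    rw [Algebra.norm_eq_norm_adjoin]
    have h := Algebra.PowerBasis.norm_gen_eq_coeff_zero_minpoly
      (IntermediateField.adjoin.powerBasis hint)
    rw [IntermediateField.adjoin.powerBasis_gen, IntermediateField.minpoly_gen,
      IntermediateField.adjoin.powerBasis_dim] at h
    rw [h]
  have hdeg := Module.finrank_mul_finrank F (IntermediateField.adjoin F {x}) L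
  rw [IntermediateField.adjoin.finrank hint] at hdeg
  have h0 : (minpoly F x).coeff 0 ≠ 0 := coeff_zero_minpoly_ne_zero hx
  have hpos : 0 < Module.finrank (IntermediateField.adjoin F {x}) L := Module.finrank_pos
  rw [ord, if_neg hx, hnorm, nu_pow, nu_mul (pow_ne_zero _ (by simp)) h0, nu_neg_one_pow, zero_add,
    ← hdeg]
  congr 1
  push_cast
  rw [mul_comm, mul_div_mul_right _ _ (by exact_mod_cast hpos.ne')]

theorem ord_algHom {L' : Type*} [Field L'] [Algebra F L'] (σ : L →ₐ[F] L') (x : L) :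
    ord F (σ x) = ord F x := by
  by_cases hx : x = 0
  · simp [hx, ord]
  · rw [ord, ord, if_neg hx, if_neg (by simpa using hx), minpoly.algHom_eq σ σ.injective]

/-- The order is additive on products: compute both sides in the finite extension `F(x, y)`. -/
theorem ord_mul [Algebra.IsAlgebraic F L] (x y : L) : ord F (x * y) = ord F x + ord F y := by
  by_cases hx : x = 0
  · simp [hx, ord]
  by_cases hy : y = 0
  · simp [hy, ord]
  let K := IntermediateField.adjoin F {x, y}
  have : FiniteDimensional F K :=
    IntermediateField.finiteDimensional_adjoin fun _ _ => Algebra.IsIntegral.isIntegral _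
  let x' : K := ⟨x, IntermediateField.subset_adjoin _ _ (by simp)⟩
  let y' : K := ⟨y, IntermediateField.subset_adjoin _ _ (by simp)⟩
  have hx' : x' ≠ 0 := fun h => hx (congrArg Subtype.val h)
  have hy' : y' ≠ 0 := fun h => hy (congrArg Subtype.val h)
  rw [show x * y = K.val (x' * y') from rfl, show x = K.val x' from rfl,
    show y = K.val y' from rfl, ord_algHom, ord_algHom, ord_algHom,
    ord_eq_norm (mul_ne_zero hx' hy'), ord_eq_norm hx', ord_eq_norm hy', map_mul,
    nu_mul (Algebra.norm_ne_zero_iff.2 hx') (Algebra.norm_ne_zero_iff.2 hy'),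
    ← WithTop.coe_add, Int.cast_add, add_div]

theorem ord_one : ord F (1 : L) = 0 := by
  have h : nu F (-1) = 0 := by simpa using nu_neg_one_pow (F := F) 1
  simp [ord, minpoly.one, Polynomial.coeff_one, h]

end Order

/-! ### Units of the integral closure -/

section IntegralClosure

variable {F : Type*} [Field F] [ValuativeRel F] [TopologicalSpace F] [IsNonarchimedeanLocalField F]
variable {L : Type*} [Field L] [Algebra F L] [Algebra 𝒪[F] L] [IsScalarTower 𝒪[F] F L]

theorem coeff_zero_minpoly {F : Type*} [Field F] [ValuativeRel F] {L : Type*} [Field L]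
    [Algebra F L] [Algebra 𝒪[F] L] [IsScalarTower 𝒪[F] F L] {x : L} (hx : IsIntegral 𝒪[F] x) :
    (minpoly F x).coeff 0 = (((minpoly 𝒪[F] x).coeff 0 : 𝒪[F]) : F) := by
  rw [minpoly.isIntegrallyClosed_eq_field_fractions' F hx, Polynomial.coeff_map]
  rfl

theorem ord_nonneg [Algebra.IsAlgebraic F L] {x : L} (hx : IsIntegral 𝒪[F] x) : 0 ≤ ord F x := by
  by_cases hx0 : x = 0
  · simp [ord, hx0]
  have h0 := coeff_zero_minpoly_ne_zero (F := F) hx0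
  have hnn : 0 ≤ nu F ((minpoly F x).coeff 0) := by
    rw [← mem_integer_iff_nu h0, coeff_zero_minpoly hx]
    exact SetLike.coe_mem _
  rw [ord, if_neg hx0]
  have : (0 : ℚ) ≤ nu F ((minpoly F x).coeff 0) / (minpoly F x).natDegree := by positivity
  exact_mod_cast this

/-- An integral element of order zero is a unit, because the constant coefficient of its minimal
polynomial is one. -/
theorem isUnit_of_ord_eq_zero [Algebra.IsAlgebraic F L] {x : integralClosure 𝒪[F] L}
    (h : ord F (x : L) = 0) : IsUnit x := by
  have hx0 : (x : L) ≠ 0 := by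
    intro hx0
    simp [ord, hx0] at h
  have h0 := coeff_zero_minpoly_ne_zero (F := F) hx0
  have hdeg : 0 < (minpoly F (x : L)).natDegree :=
    minpoly.natDegree_pos (Algebra.IsIntegral.isIntegral _)
  rw [ord, if_neg hx0, ← WithTop.coe_zero, WithTop.coe_inj, div_eq_zero_iff] at h
  have hnu : nu F ((minpoly F (x : L)).coeff 0) = 0 := by
    rcases h with h | h
    · exact_mod_cast h
    · exact absurd h (by exact_mod_cast hdeg.ne')
  have hu : IsUnit ((minpoly 𝒪[F] (x : L)).coeff 0) := by
    rw [isUnit_iff_nu, ← coeff_zero_minpoly x.2]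
    exact ⟨h0, hnu⟩
  have hx : minpoly 𝒪[F] (x : L) = minpoly 𝒪[F] x :=
    minpoly.algHom_eq (integralClosure 𝒪[F] L).val Subtype.val_injective x
  have hdvd : x ∣ algebraMap 𝒪[F] (integralClosure 𝒪[F] L) ((minpoly 𝒪[F] (x : L)).coeff 0) := by
    have h1 := minpoly.aeval 𝒪[F] x
    rw [← hx, ← Polynomial.divX_mul_X_add (minpoly 𝒪[F] (x : L)), map_add, map_mul,
      Polynomial.aeval_X, Polynomial.aeval_C] at h1
    rw [← dvd_neg, ← eq_neg_of_add_eq_zero_left h1]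
    exact dvd_mul_left _ _
  exact isUnit_of_dvd_unit hdvd (hu.map _)

theorem ord_eq_zero_of_isUnit [Algebra.IsAlgebraic F L] {x : integralClosure 𝒪[F] L}
    (h : IsUnit x) : ord F (x : L) = 0 := by
  obtain ⟨y, hy⟩ := h.exists_right_inv
  have h1 : ord F (x : L) + ord F (y : L) = 0 := by
    rw [← ord_mul, ← ord_one (F := F) (L := L)]
    exact congrArg (fun z : integralClosure 𝒪[F] L => ord F (z : L)) hy
  exact ((add_eq_zero_iff_of_nonneg (ord_nonneg x.2) (ord_nonneg y.2)).1 h1).1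

/-- Elements of the Jacobson radical are not units. -/
theorem ord_ne_zero_of_mem_jacobson [Algebra.IsAlgebraic F L] {x : integralClosure 𝒪[F] L}
    (h : x ∈ Ideal.jacobson (⊥ : Ideal (integralClosure 𝒪[F] L))) : ord F (x : L) ≠ 0 := by
  intro h0
  have htop := Ideal.eq_top_of_isUnit_mem _ h (isUnit_of_ord_eq_zero h0)
  rw [Ideal.jacobson_eq_top_iff] at htop
  exact bot_ne_top htop

theorem isUnit_add_of_mem_jacobson {R : Type*} [CommRing R] {u x : R} (hu : IsUnit u)
    (hx : x ∈ Ideal.jacobson (⊥ : Ideal R)) : IsUnit (u + x) := by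
  obtain ⟨u, rfl⟩ := hu
  have h := Ideal.mem_jacobson_bot.1 hx (↑u⁻¹ : R)
  have : (u : R) + x = u * (x * ↑u⁻¹ + 1) := by
    rw [mul_add, mul_comm x, Units.mul_inv_cancel_left]
    ring
  rw [this]
  exact u.isUnit.mul h

/-- A nontrivial root of unity of invertible order is incongruent to `1` modulo every maximal
ideal. -/
theorem isUnit_sub_one_of_pow_eq_one {R : Type*} [CommRing R] [IsDomain R] {u : R} {n : ℕ}
    (hn : IsUnit (n : R)) (hu : u ^ n = 1) (h1 : u ≠ 1) : IsUnit (u - 1) := by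
  have hsum : ∑ i ∈ Finset.range n, u ^ i = 0 := by
    have h := geom_sum_mul u n
    rw [hu, sub_self, mul_eq_zero] at h
    exact h.resolve_right (sub_ne_zero.2 h1)
  have hdvd : u - 1 ∣ ∑ i ∈ Finset.range n, (u ^ i - 1) :=
    Finset.dvd_sum fun i _ => sub_one_dvd_pow_sub_one u i
  rw [Finset.sum_sub_distrib, hsum, zero_sub, Finset.sum_const, Finset.card_range, nsmul_eq_mul,
    mul_one, dvd_neg] at hdvd
  exact isUnit_of_dvd_unit hdvd hn

end IntegralClosure

/-! ### Conjugates of an element and of its standard representative -/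

section Embeddings

variable {F : Type*} [Field F] [ValuativeRel F] [TopologicalSpace F] [IsNonarchimedeanLocalField F]
variable {E : Type*} [Field E] [ValuativeRel E] [TopologicalSpace E] [IsNonarchimedeanLocalField E]
variable [Algebra F E] [ValuativeExtension F E]
/-- Conjugates of an element `s` of `C_E` that differ, differ as much as possible:
their quotient is a nontrivial root of unity of order prime to the residue characteristic. -/
theorem exists_isUnit_sub_eq {L : Type*} [Field L] [Algebra F L] [Algebra 𝒪[F] L] {ϖ : F}
    (hϖ : IsUniformiser F ϖ)
    (htame : (ramIdx F E).Coprime (residueChar F)) {s : Eˣ} (hs : s ∈ standardGroup F E ϖ)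
    (σ σ' : E →ₐ[F] L) (h : σ s ≠ σ' s) :
    ∃ u : integralClosure 𝒪[F] L, IsUnit (u - 1) ∧ σ s = σ' s * u := by
  obtain ⟨ζ, ⟨m, hm, hζ⟩, hsζ⟩ := exists_pow_eq_of_mem_standardGroup hϖ hs
  -- `s ^ (e m)` lies in `F`, so that it has the same image under all embeddings
  have hpow (τ : E →ₐ[F] L) : τ s ^ (ramIdx F E * m) = algebraMap F L (ϖ ^ nu E (s : E)) ^ m := by
    rw [pow_mul, ← map_pow τ, hsζ, map_mul, mul_pow, ← map_pow τ ζ, hζ, map_one, mul_one,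
      ← map_zpow₀, AlgHom.commutes]
  have hs0 : σ' s ≠ 0 := by simp
  have hcop := htame.mul_left hm
  have hu : (σ s / σ' s) ^ (ramIdx F E * m) = 1 := by
    rw [div_pow, hpow, ← hpow σ', div_self (pow_ne_zero _ hs0)]
  have hN : 0 < ramIdx F E * m := Nat.pos_of_ne_zero fun h0 => by
    simpa [h0] using natCast_residue_ne_zero hcop
  have hint : IsIntegral 𝒪[F] (σ s / σ' s) := IsIntegral.of_pow hN (hu ▸ isIntegral_one)
  refine ⟨⟨σ s / σ' s, hint⟩, isUnit_sub_one_of_pow_eq_one (n := ramIdx F E * m) ?_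
    (Subtype.ext hu) ?_, (mul_div_cancel₀ _ hs0).symm⟩
  · simpa using (isUnit_natCast_integer hcop).map (algebraMap 𝒪[F] (integralClosure 𝒪[F] L))
  · intro h1
    exact h ((div_eq_one_iff_eq hs0).1 (congrArg Subtype.val h1))

variable {L : Type*} [Field L] [Algebra F L] [Algebra 𝒪[F] L] [IsScalarTower 𝒪[F] F L]

theorem isIntegral_embedding (σ : E →ₐ[F] L) (b : 𝒪[E]) : IsIntegral 𝒪[F] (σ b) := by
  have := finite_integer F E
  have h : IsIntegral 𝒪[F] (b : E) :=
    (Algebra.IsIntegral.isIntegral (R := 𝒪[F]) b).map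
      (IsScalarTower.toAlgHom 𝒪[F] 𝒪[E] E)
  exact h.map (σ.restrictScalars 𝒪[F])

/-- The restriction of an embedding of `E` to the ring of integers. -/
noncomputable def integerEmbedding (σ : E →ₐ[F] L) : 𝒪[E] →+* integralClosure 𝒪[F] L :=
  ((σ : E →+* L).comp 𝒪[E].subtype).codRestrict _ (isIntegral_embedding σ)

/-- Embeddings map `𝓂[E]` into every maximal ideal: its elements have a power in
`𝓂[F] 𝒪[E]`. -/
theorem integerEmbedding_mem_jacobson (σ : E →ₐ[F] L) {y : 𝒪[E]} (hy : y ∈ 𝓂[E]) :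
    integerEmbedding σ y ∈ Ideal.jacobson (⊥ : Ideal (integralClosure 𝒪[F] L)) := by
  refine Submodule.mem_sInf.2 fun (J : Ideal (integralClosure 𝒪[F] L)) hJ => ?_
  have hJmax : J.IsMaximal := hJ.2
  have hJF : J.under 𝒪[F] = 𝓂[F] := IsLocalRing.eq_maximalIdeal inferInstance
  have hle : 𝓂[F].map (algebraMap 𝒪[F] 𝒪[E]) ≤ J.comap (integerEmbedding σ) := by
    rw [Ideal.map_le_iff_le_comap]
    intro a ha
    have ha' : algebraMap 𝒪[F] (integralClosure 𝒪[F] L) a ∈ J := by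
      rw [← hJF] at ha
      exact ha
    have hcomp : integerEmbedding σ (algebraMap 𝒪[F] 𝒪[E] a) =
        algebraMap 𝒪[F] (integralClosure 𝒪[F] L) a := by
      refine Subtype.ext ?_
      change σ (algebraMap F E a) = algebraMap 𝒪[F] L a
      rw [AlgHom.commutes, IsScalarTower.algebraMap_apply 𝒪[F] F L]
      rfl
    rw [Ideal.mem_comap, Ideal.mem_comap, hcomp]
    exact ha'
  rw [map_maximalIdeal] at hle
  exact (Ideal.IsPrime.pow_le_iff (ramIdx_pos F E).ne').1 hle hy

/-- For a standard representative `s` of `β`, the conjugates of `β` have a difference of order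
`ord β`, the least possible value, if and only if those of `s` are distinct. -/
theorem ord_sub_eq_iff [Algebra.IsAlgebraic F L] {ϖ : F} (hϖ : IsUniformiser F ϖ)
    (htame : (ramIdx F E).Coprime (residueChar F)) {β : E} (hβ0 : β ≠ 0) {s : Eˣ}
    (hs : IsStandardRep F ϖ β s) (σ σ' : E →ₐ[F] L) :
    ord F (σ β - σ' β) = ord F β ↔ σ s ≠ σ' s := by
  obtain ⟨hsC, y, hy, hβ⟩ := hs
  have hσ := integerEmbedding_mem_jacobson σ hy
  have hσ' := integerEmbedding_mem_jacobson σ' hy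
  have hβfin : ord F β ≠ ⊤ := by
    rw [ord, if_neg hβ0]
    exact WithTop.coe_ne_top
  have hords : ord F (σ' s) = ord F β := by
    have hu := ord_eq_zero_of_isUnit (isUnit_add_of_mem_jacobson isUnit_one hσ')
    rw [← ord_algHom σ' β, hβ, map_mul, ord_mul]
    have : σ' (1 + (y : E)) = ((1 + integerEmbedding σ' y : integralClosure 𝒪[F] L) : L) := by
      rw [map_add, map_one]
      rfl
    rw [this, hu, add_zero]
  have hcancel {x : L} (h : ord F (σ' s * x) = ord F β) : ord F x = 0 := by
    rw [ord_mul, hords] at h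
    exact (WithTop.add_left_inj hβfin).1 (h.trans (add_zero _).symm)
  constructor
  · intro h heq
    have hfac : σ β - σ' β =
        σ' s * ((integerEmbedding σ y - integerEmbedding σ' y : integralClosure 𝒪[F] L) : L) := by
      rw [hβ, map_mul, map_mul, heq, map_add, map_add, map_one, map_one]
      change _ = σ' s * (σ y - σ' y)
      ring
    rw [hfac] at h
    exact ord_ne_zero_of_mem_jacobson (Ideal.sub_mem _ hσ hσ') (hcancel h)
  · intro hne
    obtain ⟨u, hu, hsu⟩ := exists_isUnit_sub_eq hϖ htame hsC σ σ' hne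
    have hunit := isUnit_add_of_mem_jacobson hu
      (Ideal.sub_mem _ (Ideal.mul_mem_left _ u hσ) hσ')
    have hfac : σ β - σ' β = σ' s *
        ((u - 1 + (u * integerEmbedding σ y - integerEmbedding σ' y) :
          integralClosure 𝒪[F] L) : L) := by
      rw [hβ, map_mul, map_mul, hsu, map_add, map_add, map_one, map_one]
      change _ = σ' s * ((u : L) - 1 + (u * σ y - σ' y))
      ring
    rw [hfac, ord_mul, ord_eq_zero_of_isUnit hunit, hords, add_zero]

end Embeddings

end LocalFieldExt

theorem mainTheorem9
    {F : Type*} [Field F] [ValuativeRel F] [TopologicalSpace F] [IsNonarchimedeanLocalField F]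
    {E : Type*} [Field E] [ValuativeRel E] [TopologicalSpace E] [IsNonarchimedeanLocalField E]
    [Algebra F E] [FiniteDimensional F E] [ValuativeExtension F E]
    (htame : LocalFieldExt.IsTamelyRamified F E)
    (ϖ : F) (hϖ : LocalFieldExt.IsUniformiser F ϖ)
    (β : E) (hβ : β ≠ 0) (hgen : Algebra.adjoin F {β} = ⊤)
    (r : ℚ) (hr : LocalFieldExt.ord F β = ((-r : ℚ) : WithTop ℚ)) :
    List.TFAE
      [LocalFieldExt.IsMinimal F ϖ β,
       Algebra.adjoin F {(LocalFieldExt.sr F ϖ β : E)} = ⊤,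
       ∀ σ σ' : E →ₐ[F] AlgebraicClosure F, σ ≠ σ' →
         LocalFieldExt.ord F (σ β - σ' β) = ((-r : ℚ) : WithTop ℚ)] := by
  have hs : LocalFieldExt.IsStandardRep F ϖ β (LocalFieldExt.sr F ϖ β) :=
    Classical.epsilon_spec (LocalFieldExt.exists_isStandardRep htame.1 hϖ hβ)
  tfae_have 1 ↔ 2 :=
    LocalFieldExt.isMinimal_iff_adjoin_standardRep_eq_top htame.1 hϖ hgen hs
  tfae_have 2 ↔ 3 := by
    rw [← hr]
    simp only [LocalFieldExt.ord_sub_eq_iff hϖ htame.1 hβ hs]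
    have := LocalFieldExt.separable_of_isTamelyRamified (E := E) htame.1
    rw [← IntermediateField.adjoin_simple_toSubalgebra_of_isAlgebraic
      (Algebra.IsAlgebraic.isAlgebraic _), ← IntermediateField.top_toSubalgebra,
      IntermediateField.toSubalgebra_inj,
      Field.primitive_element_iff_algHom_eq_of_eval' F (AlgebraicClosure F)
        (fun x => IsAlgClosed.splits _)]
    exact ⟨fun h σ σ' hne => h.ne hne, fun h σ σ' heq => by_contra fun hne => h σ σ' hne heq⟩
  tfae_finish
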